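/- **Definitions.** Let $P$ be a finite set of participants. An access structure on $P$ is an upward closed family $\Gamma$ of subsets of $P$ (the qualified subsets). Let $A_1,\dots,A_n$ be its minimal qualified subsets; for $\varepsilon\in\{0,1\}$ let $A_i^{\varepsilon}$ be $A_i$ if $\varepsilon=1$ and $P\setminus A_i$ if $\varepsilon=0$. $\Gamma$ is *universal* (with $n$ minimal qualified sets), denoted $\mathcal U_n$, if none of the $2^n$ sets $\bigcap_i A_i^{\varepsilon_i}$ is empty; it is the *normalized* universal structure $\mathcal U_n^*$ if $\bigcap_i A_i^{\varepsilon_i}$ has exactly one element when not all $\varepsilon_i$ are equal, and is empty otherwise. A secret sharing scheme $\mathcal S$ consists of jointly distributed random variables with finitely many values: a secret $\xi_s$ and a share $\xi_p$ for each $p\in P$. It is a perfect scheme realizing $\Gamma$ if the Shannon entropy $H(\xi_s)$ is positive, the shares of every qualified set determine the secret with probability one, and the shares of every unqualified set are jointly independent of the secret. The relative share size of $p$ is $H(\xi_p)/H(\xi_s)$, the complexity $\sigma(\mathcal S)$ is the maximum of the relative share sizes, and the complexity $\sigma(\Gamma)$ is the infimum of $\sigma(\mathcal S)$ over all perfect schemes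 $\mathcal S$ realizing $\Gamma$. Let $h(n)=\sum_{0<j<n}1/j$, let $f_n(i)=(n-i)\bigl(h(n)-h(n-i)\bigr)$ for $0\le i<n$ and $f_n(n)=1$, and let $M_n=\max\{f_n(i):1\le i<n\}$ for $n\ge2$. **Theorem** (the complexity of $\mathcal U_n$ is asymptotically at most $n/e$). 1. For every $n\ge 2$, the normalized structure $\mathcal U_n^*$ is realized by a perfect scheme of complexity $M_n$ in which every participant belonging to exactly $i$ minimal qualified sets has relative share size exactly $f_n(i)$. 2. For every $n\ge 2$, every universal structure $\mathcal U_n$ with $n$ minimal qualified sets is realized by a perfect scheme of complexity $M_n$ in which every participant belonging to exactly $i$ minimal qualified sets ($0\le i\le n$) has relative share size exactly $f_n(i)$. In particular $\sigma(\mathcal U_n)\le M_n$. 3. As $n\to\infty$, $M_n=\dfrac ne+\dfrac{e-1}{2e}+O(1/n)$. 4. There is a constant $C$ such that $\sigma(\mathcal U_n)\le n/e+C$ for every $n\ge 1$ and every universal structure $\mathcal U_n$ with $n$ minimal qualified sets. 5. For every $n\ge2$, $$M_n<\frac ne+\frac{e-1}{2e}+\frac1{3n}<\frac ne+\frac12,$$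 and hence $\sigma(\mathcal U_n)<n/e+\tfrac12$ for every universal structure $\mathcal U_n$ with $n$ minimal qualified sets. -/

import Mathlib

open Asymptotics Filter

universe u

/-! An access structure on the finite set `P` of participants is an upward closed family
`Γ : UpperSet (Set P)` of subsets of `P`, the qualified subsets. -/

/-- The minimal qualified subsets of the access structure `Γ`. -/
def minimalQualified {P : Type u} (Γ : UpperSet (Set P)) : Set (Set P) :=
  {A | Minimal (fun B => B ∈ Γ) A}

/-- The class (Boolean combination) `⋂ A_i ^ ε_i` of participants, where `E` is the set of those
minimal qualified `A_i` with `ε_i = 1`. -/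
def participantClass {P : Type u} (Γ : UpperSet (Set P)) (E : Set (Set P)) : Set P :=
  {p | ∀ A ∈ minimalQualified Γ, (p ∈ A ↔ A ∈ E)}

/-- The number of minimal qualified subsets containing the participant `p`. -/
noncomputable def level {P : Type u} (Γ : UpperSet (Set P)) (p : P) : ℕ :=
  {A ∈ minimalQualified Γ | p ∈ A}.ncard

/-- `Γ` is a universal access structure with `n` minimal qualified subsets: none of the `2 ^ n`
Boolean combinations of these is empty. -/
def IsUniversal {P : Type u} (n : ℕ) (Γ : UpperSet (Set P)) : Prop :=
  (minimalQualified Γ).ncard = n ∧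
    ∀ E ⊆ minimalQualified Γ, (participantClass Γ E).Nonempty

/-- `Γ` is the normalized universal structure with `n` minimal qualified subsets: the Boolean
combination has exactly one element when not all `ε_i` are equal, and is empty otherwise. -/
def IsNormalizedUniversal {P : Type u} (n : ℕ) (Γ : UpperSet (Set P)) : Prop :=
  (minimalQualified Γ).ncard = n ∧
    (∀ E ⊆ minimalQualified Γ, E ≠ ∅ → E ≠ minimalQualified Γ →
      ∃ p, participantClass Γ E = {p}) ∧
    participantClass Γ ∅ = ∅ ∧ participantClass Γ (minimalQualified Γ) = ∅

/-- A secret sharing scheme on the set `P` of participants: a finite probability space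
carrying a secret and one share for each participant, all random variables with finitely many
values. -/
structure SecretSharingScheme (P : Type u) where
  /-- The sample space. -/
  Ω : Type
  [fintypeΩ : Fintype Ω]
  /-- The probabilities of the sample points. -/
  weight : Ω → ℝ
  weight_nonneg : ∀ ω, 0 ≤ weight ω
  sum_weight : ∑ ω, weight ω = 1
  /-- The possible secrets. -/
  Secret : Type
  [fintypeSecret : Fintype Secret]
  /-- The possible shares of each participant. -/
  Share : P → Type
  [fintypeShare : ∀ p, Fintype (Share p)]
  secret : Ω → Secret
  share : ∀ p, Ω → Share p

namespace SecretSharingScheme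

attribute [instance] fintypeΩ fintypeSecret fintypeShare

variable {P : Type u} (S : SecretSharingScheme P)

/-- The probability of an event. -/
noncomputable def prob (E : Set S.Ω) : ℝ := ∑ ω, E.indicator S.weight ω

/-- The Shannon entropy of a random variable (in nats; `Real.negMulLog x = - x * log x`). -/
noncomputable def entropy {α : Type*} [Fintype α] (X : S.Ω → α) : ℝ :=
  ∑ a, Real.negMulLog (S.prob (X ⁻¹' {a}))

/-- The joint share of a coalition `B`. -/
def shares (B : Set P) (ω : S.Ω) : ∀ p : B, S.Share p := fun p => S.share p ω

/-- The shares of `B` determine the secret (with probability one). -/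
def Recovers (B : Set P) : Prop :=
  ∀ ω ω', 0 < S.weight ω → 0 < S.weight ω' → S.shares B ω = S.shares B ω' →
    S.secret ω = S.secret ω'

/-- The shares of `B` are statistically independent of the secret. -/
def NoInformation (B : Set P) : Prop :=
  ∀ (s : S.Secret) (x : ∀ p : B, S.Share p),
    S.prob (S.secret ⁻¹' {s} ∩ S.shares B ⁻¹' {x}) =
      S.prob (S.secret ⁻¹' {s}) * S.prob (S.shares B ⁻¹' {x})

/-- `S` is a perfect scheme, with a non-degenerate secret, realizing `Γ`. -/
def Realizes (Γ : UpperSet (Set P)) : Prop :=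
  0 < S.entropy S.secret ∧ (∀ B ∈ Γ, S.Recovers B) ∧ ∀ B ∉ Γ, S.NoInformation B

/-- The size of the share of `p` divided by the size of the secret. -/
noncomputable def relativeSize (p : P) : ℝ := S.entropy (S.share p) / S.entropy S.secret

/-- The complexity of a scheme: the largest relative share size. -/
noncomputable def complexity : ℝ := ⨆ p, S.relativeSize p

end SecretSharingScheme

/-- The complexity of an access structure: the infimum of the complexities of the perfect schemes
realizing it. -/
noncomputable def accessComplexity {P : Type u} (Γ : UpperSet (Set P)) : ℝ :=
  sInf {c | ∃ S : SecretSharingScheme P, S.Realizes Γ ∧ S.complexity = c}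

/-- `h(n) = ∑_{0 < j < n} 1 / j`. -/
noncomputable def harmonicBelow (n : ℕ) : ℝ := ∑ j ∈ Finset.Ico 1 n, 1 / (j : ℝ)

/-- `f_n(i) = (n - i) (h(n) - h(n - i))` for `i < n`, and `f_n(n) = 1`. -/
noncomputable def shareSize (n i : ℕ) : ℝ :=
  if i = n then 1 else ((n : ℝ) - i) * (harmonicBelow n - harmonicBelow (n - i))

/-- `max {f_n(i) : 1 ≤ i < n}`. -/
noncomputable def maxShareSize (n : ℕ) : ℝ := ⨆ i : Finset.Ico 1 n, shareSize n i

/-!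
The scheme is linear over the field with two elements. Let `A_0, …, A_{n-1}` be the minimal qualified
sets, and attach to a participant `p` the set `E_p` of the indices `i` with `p ∈ A_i`. A word is an
arrangement of all `n` indices. The *left-normed bracket* of a word is the iterated commutator
`⁅…⁅⁅w₁, w₂⁆, w₃⁆, …, wₙ⁆` of its letters in the free associative algebra. By the Jacobi identity,
the brackets of the words beginning with a fixed letter `i` span all brackets
(`bracketWord_mem_span`), and they are independent (`exists_functional_bracketWord_cons`).

A secret is a function on words of the form `w ↦ φ ⁅w⁆` with `φ` linear, so it is determined by its
values on the words beginning with `i`, which are arbitrary, and there are `2 ^ (n - 1)!` secrets.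
The share of a participant with index set `E` is a function `x` on the words beginning in `E` of
which only this much is required: if the part of the word behind its leading run of letters of `E`
is fixed, then `x` is a linear functional of the bracket of that run (`shareSpace`). The scheme picks
uniformly a family of shares whose sum is a secret.

* The secret is recovered from `A_i`, because at words beginning with `i` only the members of `A_i`
  contribute to the sum (`jointShares.secret_eq_zero`).
* If `B` is unqualified then the sets `E_p` with `p ∉ B` cover all indices. Any secret is the sum of
  shares of these participants alone: give its value at a word to the participant with the longest
  leading run. Whether a participant wins does not depend on the order of the letters of its run, so
  these are legitimate shares (`exists_shares_sum_eq`). Hence zero shares of `B` are compatible with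
  every secret, and `B` has no information.
* Every share occurs in the scheme, since participants belonging to a single minimal qualified set
  may hold any function on the words beginning with its index (`jointShares.share_surjective`).
* A share is freely determined by its values at the words that begin with the least letter of their
  leading run (`card_shareSpace`). Counting these by inserting the letters of `E` in increasing order
  gives `(n - 1)! f_n(|E|)` (`shareDim_eq`).

For the analysis put `r = n - i`, so that `f_n(i) = r ∑_{r ≤ j < n} 1 / j`. The sum is compared with
logarithms by the trapezoid rule and by its first Euler–Maclaurin correction (`le_sum_Ico_inv`,
`sum_Ico_inv_le`). Together with `t ≤ e ^ (t - 1)` this gives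
`f_n(i) ≤ n / e + (e - 1) / (2 e) + 1 / (12 r) + O(1 / n)` with an explicit error term
(`mul_sum_Ico_inv_le`), and at the maximum `r ≥ n / e - 1`. For `n < 10` the values are computed. The
choice `r = ⌊n / e⌋` gives the lower bound (`le_maxShareSize`).
-/

/-! ### Left-normed brackets in the free associative algebra -/

section FreeBracket

attribute [local instance] LieRing.ofAssociativeRing

variable (K : Type*) [CommRing K] {α : Type*}

/-- The free associative algebra on the letters `α`. -/
abbrev WordAlgebra (K : Type*) [CommRing K] (α : Type*) : Type _ := MonoidAlgebra K (FreeMonoid α)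

/-- The noncommutative monomial of a word. -/
noncomputable def wordMonomial (w : List α) : WordAlgebra K α :=
  MonoidAlgebra.single (FreeMonoid.ofList w) 1

/-- The left-normed bracket `⁅…⁅⁅z, a₁⁆, a₂⁆, …, aₖ⁆`. -/
noncomputable def bracketFrom (z : WordAlgebra K α) (w : List α) : WordAlgebra K α :=
  w.foldl (fun x a => ⁅x, wordMonomial K [a]⁆) z

/-- The left-normed bracket `⁅…⁅a₁, a₂⁆, …, aₖ⁆` of a word, with value `0` at the empty word. -/
noncomputable def bracketWord : List α → WordAlgebra K α
  | [] => 0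
  | a :: w => bracketFrom K (wordMonomial K [a]) w

variable {K}

lemma wordMonomial_mul (v w : List α) :
    wordMonomial K v * wordMonomial K w = wordMonomial K (v ++ w) := by
  simp [wordMonomial, MonoidAlgebra.single_mul_single]

lemma bracketFrom_cons (z : WordAlgebra K α) (a : α) (w : List α) :
    bracketFrom K z (a :: w) = bracketFrom K ⁅z, wordMonomial K [a]⁆ w := rfl

lemma bracketFrom_append (z : WordAlgebra K α) (v w : List α) :
    bracketFrom K z (v ++ w) = bracketFrom K (bracketFrom K z v) w := by
  simp [bracketFrom, List.foldl_append]

lemma bracketFrom_concat (z : WordAlgebra K α) (v : List α) (a : α) :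
    bracketFrom K z (v ++ [a]) = ⁅bracketFrom K z v, wordMonomial K [a]⁆ := by
  simp [bracketFrom, List.foldl_append]

lemma bracketWord_append {v : List α} (hv : v ≠ []) (w : List α) :
    bracketWord K (v ++ w) = bracketFrom K (bracketWord K v) w := by
  cases v with
  | nil => exact absurd rfl hv
  | cons a v => exact bracketFrom_append _ v w

variable (K) in
/-- The bracket with a fixed word, as a linear map in its first argument. -/
noncomputable def bracketFromLinear (w : List α) : WordAlgebra K α →ₗ[K] WordAlgebra K α where
  toFun z := bracketFrom K z w
  map_add' x y := by
    induction w generalizing x y with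
    | nil => rfl
    | cons a w ih => simp only [bracketFrom_cons, add_lie, ih]
  map_smul' c x := by
    induction w generalizing x with
    | nil => rfl
    | cons a w ih => simp only [bracketFrom_cons, smul_lie, ih, RingHom.id_apply]

@[simp] lemma bracketFromLinear_apply (w : List α) (z : WordAlgebra K α) :
    bracketFromLinear K w z = bracketFrom K z w := rfl

/-- Repeated use of the Jacobi identity: the adjoint action of `z` on a left-normed bracket is a
combination of left-normed brackets beginning with `z`. -/
lemma lie_bracketFrom_mem_span (b : α) (u : List α) (z : WordAlgebra K α) :
    ⁅z, bracketFrom K (wordMonomial K [b]) u⁆ ∈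
      Submodule.span K {y | ∃ v, v.Perm (b :: u) ∧ y = bracketFrom K z v} := by
  induction u using List.reverseRecOn generalizing z with
  | nil => exact Submodule.subset_span ⟨[b], List.Perm.refl _, rfl⟩
  | append_singleton u a ih =>
    rw [bracketFrom_concat, leibniz_lie, ← lie_skew (bracketFrom K _ u) ⁅z, _⁆, ← sub_eq_add_neg]
    refine Submodule.sub_mem _ ?_ ?_
    · change bracketFromLinear K [a] ⁅z, bracketFrom K (wordMonomial K [b]) u⁆ ∈ _
      refine Submodule.span_induction (p := fun y _ => bracketFromLinear K [a] y ∈ _)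
        ?_ (by rw [map_zero]; exact zero_mem _) (fun x y _ _ hx hy => by rw [map_add]; exact add_mem hx hy)
        (fun c x _ hx => by rw [map_smul]; exact Submodule.smul_mem _ c hx) (ih z)
      rintro _ ⟨v, hv, rfl⟩
      refine Submodule.subset_span ⟨v ++ [a], hv.append_right [a], ?_⟩
      rw [bracketFromLinear_apply, bracketFrom_append]
    · refine Submodule.span_mono ?_ (ih ⁅z, wordMonomial K [a]⁆)
      rintro _ ⟨v, hv, rfl⟩
      refine ⟨a :: v, ?_, rfl⟩
      exact (hv.cons a).trans (List.perm_append_comm (l₁ := [a]) (l₂ := b :: u))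

/-- The brackets of the rearrangements of a word that begin with a given letter of that word span
the brackets of all rearrangements. -/
lemma bracketWord_mem_span {i : α} {w : List α} (hi : i ∈ w) :
    bracketWord K w ∈
      Submodule.span K {y | ∃ v, (i :: v).Perm w ∧ y = bracketWord K (i :: v)} := by
  obtain ⟨s, t, rfl⟩ := List.append_of_mem hi
  cases s with
  | nil => exact Submodule.subset_span ⟨t, List.Perm.refl _, rfl⟩
  | cons b u =>
    have h : bracketWord K (b :: u ++ i :: t) =
        -bracketFromLinear K t
          ⁅wordMonomial K [i], bracketFrom K (wordMonomial K [b]) u⁆ := by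
      rw [bracketWord_append (by simp), bracketFrom_cons, ← map_neg, lie_skew]
      rfl
    rw [h]
    refine Submodule.neg_mem _ ?_
    refine Submodule.span_induction (p := fun y _ => bracketFromLinear K t y ∈ _)
        ?_ (by rw [map_zero]; exact zero_mem _) (fun x y _ _ hx hy => by rw [map_add]; exact add_mem hx hy)
        (fun c x _ hx => by rw [map_smul]; exact Submodule.smul_mem _ c hx)
        (lie_bracketFrom_mem_span b u (wordMonomial K [i]))
    rintro _ ⟨v, hv, rfl⟩
    refine Submodule.subset_span ⟨v ++ t, ?_, ?_⟩
    · exact ((hv.append_right t).cons i).trans List.perm_middle.symm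
    · rw [bracketFromLinear_apply, ← bracketFrom_append]
      rfl

/-- A linear functional vanishing at the brackets of the rearrangements of `w` beginning with `i`
vanishes at the bracket of `w`. -/
lemma eq_zero_of_forall_bracketWord_cons {i : α} {w : List α} (hi : i ∈ w)
    (φ : WordAlgebra K α →ₗ[K] K)
    (h : ∀ v, (i :: v).Perm w → φ (bracketWord K (i :: v)) = 0) : φ (bracketWord K w) = 0 := by
  refine Submodule.span_induction (p := fun y _ => φ y = 0) ?_ (map_zero φ)
    (fun x y _ _ hx hy => by rw [map_add, hx, hy, add_zero])
    (fun c x _ hx => by rw [map_smul, hx, smul_zero]) (bracketWord_mem_span hi)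
  rintro _ ⟨v, hv, rfl⟩
  exact h v hv

/-- In the expansion of the bracket of `i :: v` the only monomial beginning with `i` is that of
`i :: v` itself. -/
lemma bracketWord_cons_sub_mem_span {i : α} {v : List α} (hi : i ∉ v) :
    bracketWord K (i :: v) - wordMonomial K (i :: v) ∈
      Submodule.span K {y | ∃ z : List α, z.head? ≠ some i ∧ z ≠ [] ∧ y = wordMonomial K z} := by
  induction v using List.reverseRecOn with
  | nil => simp [bracketWord, bracketFrom]
  | append_singleton v a ih =>
    have hv : i ∉ v := fun h => hi (by simp [h])
    have ha : a ≠ i := fun h => hi (by simp [h])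
    set N := Submodule.span K
      {y | ∃ z : List α, z.head? ≠ some i ∧ z ≠ [] ∧ y = wordMonomial K z} with hN
    set r := bracketWord K (i :: v) - wordMonomial K (i :: v) with hr
    have hb : bracketWord K (i :: v) = wordMonomial K (i :: v) + r := by rw [hr]; abel
    have h1 : bracketWord K (i :: (v ++ [a])) - wordMonomial K (i :: (v ++ [a])) =
        r * wordMonomial K [a] - wordMonomial K [a] * wordMonomial K (i :: v)
          - wordMonomial K [a] * r := by
      rw [← List.cons_append, bracketWord_append (by simp), ← wordMonomial_mul]
      change ⁅bracketWord K (i :: v), wordMonomial K [a]⁆ - _ = _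
      rw [Ring.lie_def, hb]
      noncomm_ring
    rw [h1]
    refine sub_mem (sub_mem ?_ ?_) ?_
    · refine Submodule.span_induction (p := fun y _ => y * wordMonomial K [a] ∈ N)
        ?_ (by simp) (fun x y _ _ hx hy => by rw [add_mul]; exact add_mem hx hy)
        (fun c x _ hx => by rw [smul_mul_assoc]; exact Submodule.smul_mem _ c hx) (ih hv)
      rintro _ ⟨z, hz, hz0, rfl⟩
      rw [wordMonomial_mul]
      refine Submodule.subset_span ⟨_, ?_, by simp, rfl⟩
      cases z with
      | nil => exact absurd rfl hz0
      | cons b z => simpa using hz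
    · rw [wordMonomial_mul]
      exact Submodule.subset_span ⟨_, by simpa using ha, by simp, rfl⟩
    · refine Submodule.span_induction (p := fun y _ => wordMonomial K [a] * y ∈ N)
        ?_ (by simp) (fun x y _ _ hx hy => by rw [mul_add]; exact add_mem hx hy)
        (fun c x _ hx => by rw [mul_smul_comm]; exact Submodule.smul_mem _ c hx) (ih hv)
      rintro _ ⟨z, hz, hz0, rfl⟩
      rw [wordMonomial_mul]
      exact Submodule.subset_span ⟨_, by simpa using ha, by simp, rfl⟩

/-- A linear functional takes arbitrary prescribed values at the brackets of words that begin
with `i` and contain it only once. -/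
lemma exists_functional_bracketWord_cons (i : α) (Y : List α → K) :
    ∃ φ : WordAlgebra K α →ₗ[K] K, ∀ v, i ∉ v → φ (bracketWord K (i :: v)) = Y (i :: v) := by
  classical
  let φ : WordAlgebra K α →ₗ[K] K :=
    (Finsupp.linearCombination K fun z : FreeMonoid α =>
      if z.toList.head? = some i then Y z.toList else 0) ∘ₗ
      (MonoidAlgebra.coeffLinearEquiv K).toLinearMap
  have hφ (z : List α) : φ (wordMonomial K z) = if z.head? = some i then Y z else 0 := by
    simp only [φ, wordMonomial, MonoidAlgebra.coeffLinearEquiv]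
    simp
    congr
  refine ⟨φ, fun v hv => ?_⟩
  have h0 : φ (bracketWord K (i :: v) - wordMonomial K (i :: v)) = 0 := by
    refine Submodule.span_induction (p := fun y _ => φ y = 0) ?_ (map_zero φ)
      (fun x y _ _ hx hy => by rw [map_add, hx, hy, add_zero])
      (fun c x _ hx => by rw [map_smul, hx, smul_zero]) (bracketWord_cons_sub_mem_span hv)
    rintro _ ⟨z, hz, -, rfl⟩
    rw [hφ, if_neg hz]
  rw [map_sub, sub_eq_zero] at h0
  rw [h0, hφ, List.head?_cons, if_pos rfl]

end FreeBracket

/-! ### Share spaces -/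

section ShareSpace

variable {n : ℕ}

/-- The words containing every letter of `Fin n` exactly once. -/
abbrev FullWord (n : ℕ) : Type := {w : List (Fin n) // w.Perm (List.finRange n)}

instance : Finite (FullWord n) :=
  Set.Finite.to_subtype (((List.finRange n).permutations.toFinset.finite_toSet).subset
    fun _ hw => List.mem_toFinset.mpr (List.mem_permutations.mpr hw))

noncomputable instance : Fintype (FullWord n) := Fintype.ofFinite _

lemma FullWord.nodup {w : List (Fin n)} (hw : w.Perm (List.finRange n)) : w.Nodup :=
  hw.nodup_iff.mpr (List.nodup_finRange n)

/-- The space of shares of a participant belonging exactly to the minimal qualified sets with index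
in `E`: the functions `x` on full words such that, once the part of the word following the leading
run of letters of `E` is fixed, `x` depends on that run through a linear functional of its
left-normed bracket. As the empty word has bracket `0`, such a function vanishes on words beginning
outside `E`. -/
def shareSpace (E : Finset (Fin n)) : Submodule (ZMod 2) (FullWord n → ZMod 2) where
  carrier := {x | ∀ t : List (Fin n), (∀ a ∈ t.head?, a ∉ E) →
    ∃ φ : WordAlgebra (ZMod 2) (Fin n) →ₗ[ZMod 2] ZMod 2,
      ∀ w, (∀ a ∈ w, a ∈ E) → ∀ h, x ⟨w ++ t, h⟩ = φ (bracketWord (ZMod 2) w)}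
  add_mem' := by
    intro x y hx hy t ht
    obtain ⟨φ, hφ⟩ := hx t ht
    obtain ⟨ψ, hψ⟩ := hy t ht
    exact ⟨φ + ψ, fun w hw h => by simp [hφ w hw h, hψ w hw h]⟩
  zero_mem' := fun t _ => ⟨0, fun w _ h => by simp⟩
  smul_mem' := by
    intro c x hx t ht
    obtain ⟨φ, hφ⟩ := hx t ht
    exact ⟨c • φ, fun w hw h => by simp [hφ w hw h]⟩

lemma shareSpace_apply_eq_zero {E : Finset (Fin n)} {x : FullWord n → ZMod 2}
    (hx : x ∈ shareSpace E) {t : List (Fin n)} (ht : ∀ a ∈ t.head?, a ∉ E)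
    (h : t.Perm (List.finRange n)) : x ⟨t, h⟩ = 0 := by
  obtain ⟨φ, hφ⟩ := hx t ht
  rw [show x ⟨t, h⟩ = φ (bracketWord (ZMod 2) []) from hφ [] (by simp) h]
  exact map_zero φ

lemma exists_functional_of_mem_shareSpace_univ {s : FullWord n → ZMod 2}
    (hs : s ∈ shareSpace (Finset.univ : Finset (Fin n))) :
    ∃ φ : WordAlgebra (ZMod 2) (Fin n) →ₗ[ZMod 2] ZMod 2,
      ∀ σ : FullWord n, s σ = φ (bracketWord (ZMod 2) σ.1) := by
  obtain ⟨φ, hφ⟩ := hs [] (by simp)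
  refine ⟨φ, fun σ => ?_⟩
  have h : σ.1 ++ [] = σ.1 := List.append_nil _
  have := hφ σ.1 (by simp) (h.symm ▸ σ.2)
  simpa using this

lemma mem_shareSpace_univ_of_functional (φ : WordAlgebra (ZMod 2) (Fin n) →ₗ[ZMod 2] ZMod 2) :
    (fun σ : FullWord n => φ (bracketWord (ZMod 2) σ.1)) ∈
      shareSpace (Finset.univ : Finset (Fin n)) := by
  intro t ht
  have ht : t = [] := by
    cases t with
    | nil => rfl
    | cons a t => exact absurd (Finset.mem_univ a) (ht a rfl)
  subst ht
  exact ⟨φ, fun w _ h => by simp⟩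

/-- A secret is determined by its values on the words beginning with any fixed letter. -/
lemma eq_zero_of_mem_shareSpace_univ {s : FullWord n → ZMod 2}
    (hs : s ∈ shareSpace (Finset.univ : Finset (Fin n))) (i : Fin n)
    (h : ∀ σ : FullWord n, σ.1.head? = some i → s σ = 0) : s = 0 := by
  obtain ⟨φ, hφ⟩ := exists_functional_of_mem_shareSpace_univ hs
  funext σ
  rw [hφ]
  refine eq_zero_of_forall_bracketWord_cons (i := i) (σ.2.mem_iff.mpr (List.mem_finRange i)) φ ?_
  intro v hv
  rw [← hφ ⟨i :: v, hv.trans σ.2⟩]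
  exact h _ rfl

/-- The values of a secret on the words beginning with a fixed letter are arbitrary. -/
lemma exists_mem_shareSpace_univ_eq (i : Fin n) (x : FullWord n → ZMod 2) :
    ∃ s ∈ shareSpace (Finset.univ : Finset (Fin n)),
      ∀ σ : FullWord n, σ.1.head? = some i → s σ = x σ := by
  classical
  obtain ⟨φ, hφ⟩ := exists_functional_bracketWord_cons (K := ZMod 2) i
    (fun w => if h : w.Perm (List.finRange n) then x ⟨w, h⟩ else 0)
  refine ⟨_, mem_shareSpace_univ_of_functional φ, ?_⟩
  rintro ⟨w, hw⟩ hi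
  cases w with
  | nil => simp at hi
  | cons a v =>
    obtain rfl : a = i := by simpa using hi
    have hv : a ∉ v := (List.nodup_cons.mp (FullWord.nodup hw)).1
    change φ (bracketWord (ZMod 2) (a :: v)) = _
    rw [hφ v hv, dif_pos hw]

/-- A participant of level one may hold any function on the words beginning with its letter. -/
lemma mem_shareSpace_singleton {i : Fin n} {x : FullWord n → ZMod 2}
    (hx : ∀ σ : FullWord n, σ.1.head? ≠ some i → x σ = 0) : x ∈ shareSpace {i} := by
  classical
  intro t ht
  obtain ⟨φ, hφ⟩ := exists_functional_bracketWord_cons (K := ZMod 2) i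
    (fun w => if h : (w ++ t).Perm (List.finRange n) then x ⟨w ++ t, h⟩ else 0)
  refine ⟨φ, fun w hw h => ?_⟩
  have hnd := (List.nodup_append.mp (FullWord.nodup h)).1
  match w, hw, h, hnd with
  | [], _, h, _ =>
    rw [bracketWord, map_zero]
    exact hx _ fun hi => ht i (by simpa using hi) (by simp)
  | [a], hw, h, _ =>
    obtain rfl : a = i := by simpa using hw
    rw [hφ [] (by simp), dif_pos h]
  | a :: b :: w, hw, _, hnd =>
    have ha : a = i := by simpa using hw a (by simp)
    have hb : b = i := by simpa using hw b (by simp)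
    simp [ha, hb] at hnd

/-! ### Distributing a secret over a cover -/

/-- The length of the leading run of letters of `E`. -/
def runLength (E : Finset (Fin n)) (w : List (Fin n)) : ℕ := (w.takeWhile (· ∈ E)).length

lemma runLength_pos {E : Finset (Fin n)} {w : List (Fin n)} :
    0 < runLength E w ↔ ∃ a ∈ w.head?, a ∈ E := by
  cases w with
  | nil => simp [runLength]
  | cons a w => by_cases h : a ∈ E <;> simp [runLength, h]

lemma runLength_append_of_forall_mem {E : Finset (Fin n)} {w : List (Fin n)}
    (hw : ∀ a ∈ w, a ∈ E) (t : List (Fin n)) :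
    runLength E (w ++ t) = w.length + runLength E t := by
  unfold runLength
  rw [List.takeWhile_append_of_pos (by simpa using hw), List.length_append]

lemma runLength_append_lt {E : Finset (Fin n)} {w : List (Fin n)}
    (hw : ¬ ∀ a ∈ w, a ∈ E) (t : List (Fin n)) : runLength E (w ++ t) < w.length := by
  unfold runLength
  induction w with
  | nil => simp at hw
  | cons a w ih =>
    by_cases ha : a ∈ E
    · have : ¬ ∀ a ∈ w, a ∈ E := fun h => hw (by simpa [ha] using h)
      simpa [ha] using ih this
    · simp [ha]

/-- If the letters of `w` all lie in `E'`, then whether the leading `E'`-run of `w ++ t` is at least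
as long as the leading `E`-run, with ties broken by `k` and `k'`, does not depend on the order of the
letters of `w`. -/
lemma runLength_mul_add_le_iff_of_perm {E E' : Finset (Fin n)} {w w' t : List (Fin n)} (hp : w.Perm w')
    (hw : ∀ a ∈ w, a ∈ E') (k k' m : ℕ) (hk : k < m) :
    (runLength E (w ++ t) * m + k ≤ runLength E' (w ++ t) * m + k' ↔
      runLength E (w' ++ t) * m + k ≤ runLength E' (w' ++ t) * m + k') := by
  have hw' : ∀ a ∈ w', a ∈ E' := fun a ha => hw a (hp.mem_iff.mpr ha)
  by_cases h : ∀ a ∈ w, a ∈ E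
  · have h' : ∀ a ∈ w', a ∈ E := fun a ha => h a (hp.mem_iff.mpr ha)
    rw [runLength_append_of_forall_mem h, runLength_append_of_forall_mem h',
      runLength_append_of_forall_mem hw, runLength_append_of_forall_mem hw', hp.length_eq]
  · have h' : ¬ ∀ a ∈ w', a ∈ E := fun h' => h fun a ha => h' a (hp.mem_iff.mp ha)
    have key (v : List (Fin n)) (hv : ∀ a ∈ v, a ∈ E') (hv' : ¬ ∀ a ∈ v, a ∈ E) :
        runLength E (v ++ t) * m + k ≤ runLength E' (v ++ t) * m + k' := by
      have h1 : (runLength E (v ++ t) + 1) * m ≤ runLength E' (v ++ t) * m :=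
        Nat.mul_le_mul_right m (by
          have := runLength_append_lt hv' t
          rw [runLength_append_of_forall_mem hv]; omega)
      rw [add_mul, one_mul] at h1
      omega
    exact iff_of_true (key w hw h) (key w' hw' h')

/-- A secret can be written as a sum of shares of any participants whose index sets cover all
letters: its value at a word goes to the participant with the longest leading run, ties being
broken by a fixed order of the participants. -/
lemma exists_shares_sum_eq {k : ℕ} (E : Fin k → Finset (Fin n)) (C : Finset (Fin k))
    (hn : 1 ≤ n) (hC : ∀ i, ∃ p ∈ C, i ∈ E p) {s : FullWord n → ZMod 2}
    (hs : s ∈ shareSpace (Finset.univ : Finset (Fin n))) :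
    ∃ x : Fin k → FullWord n → ZMod 2, (∀ p, x p ∈ shareSpace (E p)) ∧
      (∀ p ∉ C, x p = 0) ∧ ∑ p, x p = s := by
  classical
  let key (p : Fin k) (w : List (Fin n)) : ℕ := runLength (E p) w * k + p
  let Win (p : Fin k) (w : List (Fin n)) : Prop :=
    p ∈ C ∧ 0 < runLength (E p) w ∧ ∀ q ∈ C, key q w ≤ key p w
  have hinj (p q : Fin k) (w : List (Fin n)) (h : key p w = key q w) : p = q := by
    have hp := Nat.add_mul_mod_self_right (p : ℕ) (runLength (E p) w) k
    have hq := Nat.add_mul_mod_self_right (q : ℕ) (runLength (E q) w) k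
    rw [add_comm, Nat.mod_eq_of_lt p.2] at hp
    rw [add_comm, Nat.mod_eq_of_lt q.2] at hq
    exact Fin.ext (by rw [← hp, ← hq]; exact congrArg (· % k) h)
  obtain ⟨φ, hφ⟩ := exists_functional_of_mem_shareSpace_univ hs
  refine ⟨fun p σ => if Win p σ.1 then s σ else 0, fun p t ht => ?_, fun p hp => ?_, ?_⟩
  · have ht0 : runLength (E p) t = 0 := by
      by_contra h
      obtain ⟨a, ha, ha'⟩ := runLength_pos.mp (Nat.pos_of_ne_zero h)
      exact ht a ha ha'
    by_cases hex : ∃ w₀, (∀ a ∈ w₀, a ∈ E p) ∧ (w₀ ++ t).Perm (List.finRange n) ∧ Win p (w₀ ++ t)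
    · obtain ⟨w₀, h0, h0p, hwin⟩ := hex
      refine ⟨φ ∘ₗ bracketFromLinear (ZMod 2) t, fun w hw h => ?_⟩
      have hperm : w₀.Perm w := (List.perm_append_right_iff t).mp (h0p.trans h.symm)
      have hne0 : w₀ ≠ [] := by
        rintro rfl
        exact hwin.2.1.ne' ht0
      have hne : w ≠ [] := fun hnil => hne0 (by simpa [hnil] using hperm)
      have hW : Win p (w ++ t) := by
        refine ⟨hwin.1, ?_, fun q hq => ?_⟩
        · rw [runLength_append_of_forall_mem hw]
          exact Nat.add_pos_left (List.length_pos_of_ne_nil hne) _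
        · exact (runLength_mul_add_le_iff_of_perm hperm h0 q p k q.2).mp (hwin.2.2 q hq)
      simp only [if_pos hW, hφ, LinearMap.comp_apply, bracketFromLinear_apply]
      rw [bracketWord_append hne]
    · refine ⟨0, fun w hw h => ?_⟩
      exact if_neg fun hW => hex ⟨w, hw, h, hW⟩
  · funext σ
    exact if_neg fun hW => hp hW.1
  · funext σ
    rw [Finset.sum_apply]
    obtain ⟨a, v, hσ⟩ : ∃ a v, σ.1 = a :: v := by
      refine List.exists_cons_of_length_pos ?_
      rw [σ.2.length_eq, List.length_finRange]
      exact hn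
    obtain ⟨p₀, hp₀, hap₀⟩ := hC a
    obtain ⟨p, hp, hmax⟩ := C.exists_max_image (fun p => key p σ.1) ⟨p₀, hp₀⟩
    have hrun₀ : 0 < runLength (E p₀) σ.1 := runLength_pos.mpr ⟨a, by simp [hσ], hap₀⟩
    have hrun : 0 < runLength (E p) σ.1 := by
      by_contra h0
      have h1 := hmax p₀ hp₀
      have h2 : 1 * k ≤ runLength (E p₀) σ.1 * k := Nat.mul_le_mul_right k hrun₀
      have h3 : runLength (E p) σ.1 = 0 := by omega
      have h4 := p.2
      simp only [key, h3] at h1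
      omega
    have hW : Win p σ.1 := ⟨hp, hrun, hmax⟩
    rw [Finset.sum_eq_single p, if_pos hW]
    · intro q _ hqp
      refine if_neg fun hq => hqp (hinj q p σ.1 ?_)
      exact le_antisymm (hmax q hq.1) (hq.2.2 p hp)
    · simp

end ShareSpace

/-! ### The dimension of the share spaces -/

section Dimension

variable {n : ℕ}

/-- The word begins with the least letter of a nonempty leading run of letters of `E`. A share is
freely determined by its values at these words. -/
def BeginsWithRunMin (E : Finset (Fin n)) : List (Fin n) → Prop
  | [] => False
  | y :: v => y ∈ E ∧ ∀ a ∈ v.takeWhile (· ∈ E), y ≤ a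

instance (E : Finset (Fin n)) : DecidablePred (BeginsWithRunMin E)
  | [] => inferInstanceAs (Decidable False)
  | y :: v => inferInstanceAs (Decidable (y ∈ E ∧ ∀ a ∈ v.takeWhile (· ∈ E), y ≤ a))

lemma beginsWithRunMin_cons {E : Finset (Fin n)} {y : Fin n} {v : List (Fin n)} :
    BeginsWithRunMin E (y :: v) ↔ y ∈ E ∧ ∀ a ∈ v.takeWhile (· ∈ E), y ≤ a := Iff.rfl

lemma takeWhile_append_eq {E : Finset (Fin n)} {w t : List (Fin n)} (hw : ∀ a ∈ w, a ∈ E)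
    (ht : ∀ a ∈ t.head?, a ∉ E) : (w ++ t).takeWhile (· ∈ E) = w := by
  rw [List.takeWhile_append_of_pos (by simpa using hw)]
  cases t with
  | nil => simp
  | cons a t => simp [ht a rfl]

lemma dropWhile_append_eq {E : Finset (Fin n)} {w t : List (Fin n)} (hw : ∀ a ∈ w, a ∈ E)
    (ht : ∀ a ∈ t.head?, a ∉ E) : (w ++ t).dropWhile (· ∈ E) = t := by
  rw [List.dropWhile_append_of_pos (by simpa using hw)]
  cases t with
  | nil => simp
  | cons a t => simp [ht a rfl]

lemma head?_dropWhile_notMem (E : Finset (Fin n)) (w : List (Fin n)) :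
    ∀ a ∈ (w.dropWhile (· ∈ E)).head?, a ∉ E := by
  induction w with
  | nil => simp
  | cons b w ih =>
    by_cases hb : b ∈ E
    · simpa [hb] using ih
    · simp [hb]

lemma beginsWithRunMin_append {E : Finset (Fin n)} {i : Fin n} {v t : List (Fin n)}
    (hv : ∀ a ∈ i :: v, a ∈ E) (ht : ∀ a ∈ t.head?, a ∉ E) :
    BeginsWithRunMin E (i :: v ++ t) ↔ ∀ a ∈ v, i ≤ a := by
  rw [List.cons_append, beginsWithRunMin_cons,
    takeWhile_append_eq (fun a ha => hv a (List.mem_cons_of_mem _ ha)) ht]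
  exact and_iff_right (hv i (by simp))

/-- Injectivity of the restriction of shares to the words beginning with the least letter of their
leading run. -/
lemma shareSpace_eq_zero {E : Finset (Fin n)} {x : FullWord n → ZMod 2} (hx : x ∈ shareSpace E)
    (h : ∀ σ : FullWord n, BeginsWithRunMin E σ.1 → x σ = 0) : x = 0 := by
  funext σ
  set w := σ.1.takeWhile (· ∈ E) with hw
  set t := σ.1.dropWhile (· ∈ E) with ht
  have hwt : w ++ t = σ.1 := List.takeWhile_append_dropWhile
  have hwE : ∀ a ∈ w, a ∈ E := fun a ha => by simpa using List.mem_takeWhile_imp ha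
  have htE : ∀ a ∈ t.head?, a ∉ E := head?_dropWhile_notMem E σ.1
  obtain ⟨φ, hφ⟩ := hx t htE
  have hσ : x σ = φ (bracketWord (ZMod 2) w) := by
    rw [← hφ w hwE (hwt ▸ σ.2)]
    exact congrArg x (Subtype.ext hwt.symm)
  rw [hσ]
  rcases eq_or_ne w [] with h0 | h0
  · rw [h0]
    exact map_zero φ
  · obtain ⟨i, hi, hmin⟩ := w.toFinset.exists_min_image id
      (by obtain ⟨a, ha⟩ := List.exists_mem_of_ne_nil w h0
          exact ⟨a, List.mem_toFinset.mpr ha⟩)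
    refine eq_zero_of_forall_bracketWord_cons (List.mem_toFinset.mp hi) φ fun v hv => ?_
    have hvE : ∀ a ∈ i :: v, a ∈ E := fun a ha => hwE a (hv.mem_iff.mp ha)
    have hperm : (i :: v ++ t).Perm (List.finRange n) := by
      refine (hv.append_right t).trans ?_
      rw [hwt]
      exact σ.2
    rw [← hφ (i :: v) hvE hperm]
    refine h _ ((beginsWithRunMin_append hvE htE).mpr fun a ha => ?_)
    exact hmin a (List.mem_toFinset.mpr (hv.mem_iff.mp (List.mem_cons_of_mem _ ha)))

/-- Surjectivity of the restriction of shares to the words beginning with the least letter of their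
leading run. -/
lemma exists_mem_shareSpace_eq (E : Finset (Fin n)) (y : FullWord n → ZMod 2) :
    ∃ x ∈ shareSpace E, ∀ σ : FullWord n, BeginsWithRunMin E σ.1 → x σ = y σ := by
  classical
  have hex (t : List (Fin n)) : ∃ φ : WordAlgebra (ZMod 2) (Fin n) →ₗ[ZMod 2] ZMod 2,
      (∀ a ∈ t.head?, a ∉ E) → ∀ i v, (∀ a ∈ i :: v, a ∈ E) → (∀ a ∈ v, i ≤ a) →
        ∀ h : (i :: v ++ t).Perm (List.finRange n),
          φ (bracketWord (ZMod 2) (i :: v)) = y ⟨i :: v ++ t, h⟩ := by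
    by_cases h0 : ∃ i v, (∀ a ∈ v, i ≤ a) ∧ (i :: v ++ t).Perm (List.finRange n)
    · obtain ⟨i, v, hmin, hp⟩ := h0
      obtain ⟨φ, hφ⟩ := exists_functional_bracketWord_cons (K := ZMod 2) i
        (fun w => if h : (w ++ t).Perm (List.finRange n) then y ⟨w ++ t, h⟩ else 0)
      refine ⟨φ, fun _ j u _ hmin' h => ?_⟩
      have hperm : (i :: v).Perm (j :: u) := (List.perm_append_right_iff t).mp (hp.trans h.symm)
      -- the first letter is determined by `t`, being the least letter outside `t`
      obtain rfl : i = j := by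
        apply le_antisymm
        · rcases List.mem_cons.mp (hperm.mem_iff.mpr (List.mem_cons_self (a := j) (l := u))) with
            h | h
          · exact h.ge
          · exact hmin j h
        · rcases List.mem_cons.mp (hperm.mem_iff.mp (List.mem_cons_self (a := i) (l := v))) with
            h | h
          · exact h.ge
          · exact hmin' i h
      have hnd := (List.nodup_append.mp (FullWord.nodup h)).1
      rw [hφ u (List.nodup_cons.mp hnd).1, dif_pos h]
    · exact ⟨0, fun _ i v _ hmin h => absurd ⟨i, v, hmin, h⟩ h0⟩
  choose φ hφ using hex
  refine ⟨fun σ => φ (σ.1.dropWhile (· ∈ E)) (bracketWord (ZMod 2) (σ.1.takeWhile (· ∈ E))),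
    fun t ht => ⟨φ t, fun w hw h => ?_⟩, ?_⟩
  · simp only [takeWhile_append_eq hw ht, dropWhile_append_eq hw ht]
  · rintro ⟨σ, hσ⟩ hB
    cases σ with
    | nil => exact hB.elim
    | cons i u =>
      have hi : i ∈ E := hB.1
      have hv : ∀ a ∈ i :: u.takeWhile (· ∈ E), a ∈ E := by
        intro a ha
        rcases List.mem_cons.mp ha with rfl | ha
        · exact hi
        · simpa using List.mem_takeWhile_imp ha
      have happ : i :: u.takeWhile (· ∈ E) ++ u.dropWhile (· ∈ E) = i :: u := by simp
      have := hφ (u.dropWhile (· ∈ E)) (head?_dropWhile_notMem E u) i (u.takeWhile (· ∈ E)) hv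
        hB.2 (happ ▸ hσ)
      simp only [hi, decide_true, List.takeWhile_cons_of_pos, List.dropWhile_cons_of_pos]
      rw [this]
      exact congrArg y (Subtype.ext happ)

/-- The number of words that index a basis of the share space. -/
noncomputable def shareDim (E : Finset (Fin n)) : ℕ :=
  Nat.card {σ : FullWord n // BeginsWithRunMin E σ.1}

lemma card_shareSpace (E : Finset (Fin n)) : Nat.card (shareSpace E) = 2 ^ shareDim E := by
  classical
  let f : shareSpace E → ({σ : FullWord n // BeginsWithRunMin E σ.1} → ZMod 2) :=
    fun x σ => x.1 σ.1
  have hf : Function.Bijective f := by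
    constructor
    · intro x y hxy
      have h0 : x.1 - y.1 = 0 := by
        refine shareSpace_eq_zero (sub_mem x.2 y.2) fun σ hσ => ?_
        rw [Pi.sub_apply, sub_eq_zero]
        exact congrFun hxy ⟨σ, hσ⟩
      exact Subtype.ext (sub_eq_zero.mp h0)
    · intro y
      obtain ⟨x, hx, hxy⟩ := exists_mem_shareSpace_eq E
        (fun σ => if h : BeginsWithRunMin E σ.1 then y ⟨σ, h⟩ else 0)
      refine ⟨⟨x, hx⟩, funext fun σ => ?_⟩
      rw [show f ⟨x, hx⟩ σ = x σ.1 from rfl, hxy _ σ.2, dif_pos σ.2]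
  rw [Nat.card_eq_of_bijective f hf, Nat.card_fun, Nat.card_zmod, shareDim]

/-! ### Counting words by inserting letters -/

/-- The arrangements of `z :: l` arise by inserting `z` into those of `l`. A property that is not
affected by insertions behind the first letter can thus be counted recursively. -/
lemma countP_permutations'_cons {α : Type*} (q : List α → Bool) (z : α) {l : List α} (hl : l ≠ [])
    (hq : ∀ y ys, (y :: ys).Perm l → ∀ s ∈ List.permutations'Aux z ys, q (y :: s) = q (y :: ys)) :
    (z :: l).permutations'.countP q =
      l.permutations'.countP (fun w => q (z :: w)) + l.length * l.permutations'.countP q := by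
  have hone (w : List α) (hw : w.Perm l) : (List.permutations'Aux z w).countP q =
      (if q (z :: w) then 1 else 0) + l.length * (if q w then 1 else 0) := by
    cases w with
    | nil => exact absurd hw.symm.eq_nil hl
    | cons y ys =>
      rw [List.permutations'Aux, List.countP_cons, List.countP_map, add_comm]
      congr 1
      rw [List.countP_congr (p := q ∘ List.cons y) (q := fun _ => q (y :: ys))]
      · by_cases h : q (y :: ys)
        · simp [h, List.length_permutations'Aux, ← hw.length_eq]
        · simp [h]
      · intro s hs
        simp [hq y ys hw s hs]
  have hall (L : List (List α)) (hL : ∀ w ∈ L, w.Perm l) :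
      (L.flatMap (List.permutations'Aux z)).countP q =
        L.countP (fun w => q (z :: w)) + l.length * L.countP q := by
    induction L with
    | nil => simp
    | cons w L ih =>
      rw [List.flatMap_cons, List.countP_append, hone w (hL w (by simp)),
        ih fun v hv => hL v (List.mem_cons_of_mem _ hv), List.countP_cons, List.countP_cons]
      ring
  exact hall _ fun w hw => List.mem_permutations'.mp hw

/-- The number of arrangements of `l` whose first letter has property `p`. -/
lemma countP_permutations'_head {α : Type*} (p : α → Bool) {l : List α} (hl : l ≠ []) :
    l.permutations'.countP (fun w => w.head?.any p) = l.countP p * (l.length - 1).factorial := by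
  induction l with
  | nil => exact absurd rfl hl
  | cons z l ih =>
    rcases eq_or_ne l [] with rfl | h0
    · by_cases hz : p z <;> simp [List.permutations'Aux, hz]
    · rw [countP_permutations'_cons _ z h0 (fun y ys _ s _ => rfl), ih h0]
      have hlen : l.length = l.length - 1 + 1 := by
        have := List.length_pos_of_ne_nil h0
        omega
      have hconst : l.permutations'.countP (fun w => (z :: w).head?.any p) =
          (if p z then 1 else 0) * l.length.factorial := by
        by_cases hz : p z
        · simp [hz, (List.permutations_perm_permutations' l).symm.length_eq,
            List.length_permutations]
        · simp [hz]
      rw [hconst, List.countP_cons, List.length_cons, Nat.add_sub_cancel, add_mul, add_comm]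
      congr 1
      rw [mul_left_comm]
      congr 1
      conv_lhs => rw [hlen, Nat.add_sub_cancel]
      conv_rhs => rw [hlen]
      exact (Nat.factorial_succ _).symm

lemma forall_mem_takeWhile_permutations'Aux {E : Finset (Fin n)} {y z : Fin n} (hz : z ∈ E)
    (hyz : y ≤ z) {ys s : List (Fin n)} (hs : s ∈ List.permutations'Aux z ys) :
    (∀ a ∈ s.takeWhile (· ∈ E), y ≤ a) ↔ ∀ a ∈ ys.takeWhile (· ∈ E), y ≤ a := by
  induction ys generalizing s with
  | nil =>
    obtain rfl : s = [z] := by simpa [List.permutations'Aux] using hs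
    simp [hz, hyz]
  | cons c cs ih =>
    rw [List.permutations'Aux, List.mem_cons, List.mem_map] at hs
    rcases hs with rfl | ⟨s', hs', rfl⟩
    · rw [List.takeWhile_cons_of_pos (by simpa using hz)]
      simp [hyz]
    · by_cases hc : c ∈ E
      · simp only [List.takeWhile_cons_of_pos, hc, decide_true, List.forall_mem_cons, ih hs']
      · simp [hc]

/-- The recursion for the number of words beginning with the least letter of their leading run:
the largest letter `z` of `E` either comes first, and the next letter lies outside `E`, or it is
inserted behind another word of this kind. -/
lemma countP_beginsWithRunMin_cons {E : Finset (Fin n)} {z : Fin n} {l r : List (Fin n)}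
    (hz : z ∈ E) (hl : ∀ a ∈ l, a < z) (hr : ∀ a ∈ r, a ∉ E) (hlE : ∀ a ∈ l, a ∈ E)
    (h0 : l ++ r ≠ []) :
    (z :: (l ++ r)).permutations'.countP (fun w => BeginsWithRunMin E w) =
      r.length * ((l ++ r).length - 1).factorial +
        (l ++ r).length * (l ++ r).permutations'.countP (fun w => BeginsWithRunMin E w) := by
  rw [countP_permutations'_cons _ z h0]
  · congr 1
    have hcount : (l ++ r).countP (fun a => decide (a ∉ E)) = r.length := by
      rw [List.countP_append, List.countP_eq_zero.mpr (by simpa using hlE),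
        List.countP_eq_length.mpr (by simpa using hr), zero_add]
    rw [← hcount, ← countP_permutations'_head _ h0]
    refine List.countP_congr fun w hw => ?_
    have hperm := List.mem_permutations'.mp hw
    cases w with
    | nil => exact absurd hperm.symm.eq_nil h0
    | cons b w =>
      by_cases hb : b ∈ E
      · have hbz : b < z := by
          rcases List.mem_append.mp (hperm.mem_iff.mp (List.mem_cons_self (a := b) (l := w))) with
            h | h
          · exact hl b h
          · exact absurd hb (hr b h)
        simp [beginsWithRunMin_cons, hz, hb, hbz]
      · simp [beginsWithRunMin_cons, hz, hb]
  · intro y ys hperm s hs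
    refine decide_eq_decide.mpr ?_
    rw [beginsWithRunMin_cons, beginsWithRunMin_cons]
    refine and_congr_right fun hy => forall_mem_takeWhile_permutations'Aux hz ?_ hs
    rcases List.mem_append.mp (hperm.mem_iff.mp (List.mem_cons_self (a := y) (l := ys))) with h | h
    · exact (hl y h).le
    · exact absurd hy (hr y h)

lemma countP_beginsWithRunMin {E : Finset (Fin n)} {l r : List (Fin n)}
    (hl : l.Pairwise (· > ·)) (hlE : ∀ a ∈ l, a ∈ E) (hr : ∀ a ∈ r, a ∉ E) (h0 : r ≠ []) :
    ((l ++ r).permutations'.countP (fun w => BeginsWithRunMin E w) : ℝ) =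
      r.length * ((l ++ r).length - 1).factorial *
        ∑ j ∈ Finset.Ico r.length (r.length + l.length), 1 / (j : ℝ) := by
  induction l with
  | nil =>
    have : ([] ++ r).permutations'.countP (fun w => BeginsWithRunMin E w) = 0 := by
      refine List.countP_eq_zero.mpr fun w hw => ?_
      have hperm := List.mem_permutations'.mp hw
      cases w with
      | nil => exact absurd hperm.symm.eq_nil h0
      | cons b w =>
        have hb : b ∉ E := hr b (hperm.mem_iff.mp (by simp))
        simp [beginsWithRunMin_cons, hb]
    rw [this]
    simp
  | cons z l ih =>
    obtain ⟨hzl, hl'⟩ := List.pairwise_cons.mp hl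
    have hlE' : ∀ a ∈ l, a ∈ E := fun a ha => hlE a (List.mem_cons_of_mem _ ha)
    have hlr : l ++ r ≠ [] := by simp [h0]
    rw [List.cons_append, countP_beginsWithRunMin_cons (hlE z (by simp)) hzl hr hlE' hlr]
    push_cast
    rw [ih hl' hlE', List.length_cons, List.length_cons, ← add_assoc,
      Finset.sum_Ico_succ_top (by omega), Nat.add_sub_cancel]
    have hpos : 0 < (l ++ r).length := List.length_pos_of_ne_nil hlr
    have hfac : ((l ++ r).length.factorial : ℝ) =
        (l ++ r).length * ((l ++ r).length - 1).factorial := by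
      exact_mod_cast (Nat.mul_factorial_pred hpos.ne').symm
    have hlen : ((r.length + l.length : ℕ) : ℝ) = (l ++ r).length := by
      rw [List.length_append, add_comm]
    have hne : ((l ++ r).length : ℝ) ≠ 0 := by exact_mod_cast hpos.ne'
    rw [hfac, hlen]
    field_simp
    ring

lemma countP_beginsWithRunMin_of_forall_mem {E : Finset (Fin n)} {l : List (Fin n)}
    (hl : l.Pairwise (· > ·)) (hlE : ∀ a ∈ l, a ∈ E) (h0 : l ≠ []) :
    l.permutations'.countP (fun w => BeginsWithRunMin E w) = (l.length - 1).factorial := by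
  induction l with
  | nil => exact absurd rfl h0
  | cons z l ih =>
    obtain ⟨hzl, hl'⟩ := List.pairwise_cons.mp hl
    have hlE' : ∀ a ∈ l, a ∈ E := fun a ha => hlE a (List.mem_cons_of_mem _ ha)
    rcases eq_or_ne l [] with rfl | hl0
    · simp [List.permutations'Aux, beginsWithRunMin_cons, hlE z (by simp)]
    · have := countP_beginsWithRunMin_cons (r := []) (hlE z (by simp)) hzl (by simp) hlE'
        (by simpa using hl0)
      rw [List.append_nil] at this
      rw [this, ih hl' hlE' hl0, List.length_nil, zero_mul, zero_add, List.length_cons,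
        Nat.add_sub_cancel]
      exact Nat.mul_factorial_pred (List.length_pos_of_ne_nil hl0).ne'

lemma shareDim_eq_countP (E : Finset (Fin n)) {l : List (Fin n)} (hl : l.Perm (List.finRange n)) :
    shareDim E = l.permutations'.countP (fun w => BeginsWithRunMin E w) := by
  classical
  have hnd : l.permutations'.Nodup :=
    (List.permutations_perm_permutations' l).nodup_iff.mp
      (List.nodup_permutations l (hl.nodup_iff.mpr (List.nodup_finRange n)))
  rw [List.countP_eq_length_filter, ← List.toFinset_card_of_nodup (hnd.filter _), shareDim,
    Nat.card_congr (Equiv.subtypeSubtypeEquivSubtypeInter _ _)]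
  refine Nat.subtype_card _ fun w => ?_
  rw [List.mem_toFinset, List.mem_filter, List.mem_permutations', decide_eq_true_iff]
  exact and_congr_left' ⟨fun h => h.trans hl, fun h => h.trans hl.symm⟩

lemma shareDim_eq (E : Finset (Fin n)) (hn : 1 ≤ n) :
    (shareDim E : ℝ) = shareSize n E.card * (n - 1).factorial := by
  have hcard : E.card + Eᶜ.card = n := by simp
  set l := E.sort (· ≥ ·) with hl
  have hlE : ∀ a ∈ l, a ∈ E := fun a ha => (Finset.mem_sort _).mp ha
  have hsorted : l.Pairwise (· > ·) := E.sortedGT_sort.pairwise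
  have hperm : (l ++ Eᶜ.toList).Perm (List.finRange n) := by
    refine (List.perm_ext_iff_of_nodup ?_ (List.nodup_finRange n)).mpr fun a => ?_
    · refine List.nodup_append.mpr ⟨E.sort_nodup _, Finset.nodup_toList _, fun a ha b hb hab => ?_⟩
      rw [Finset.mem_toList, Finset.mem_compl, ← hab] at hb
      exact hb (hlE a ha)
    · simp [l, em]
  have hlen : (l ++ Eᶜ.toList).length = n := by simp [l, hcard]
  rw [shareDim_eq_countP E hperm]
  by_cases hE : E.card = n
  · have hc : Eᶜ.toList = [] := by
      rw [Finset.toList_eq_nil, ← Finset.card_eq_zero]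
      omega
    rw [hc, List.append_nil] at hlen ⊢
    rw [countP_beginsWithRunMin_of_forall_mem hsorted hlE
      (List.ne_nil_of_length_pos (by omega)), hlen, hE, shareSize, if_pos rfl, one_mul]
  · have hc : Eᶜ.toList ≠ [] := List.ne_nil_of_length_pos (by rw [Finset.length_toList]; omega)
    rw [countP_beginsWithRunMin hsorted hlE (by simp) hc, hlen, shareSize, if_neg hE]
    have h1 : Eᶜ.toList.length = n - E.card := by rw [Finset.length_toList]; omega
    have h2 : l.length = E.card := by simp [l]
    rw [h1, h2, Nat.sub_add_cancel (by omega), harmonicBelow, harmonicBelow,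
      ← Finset.sum_Ico_consecutive _ (show 1 ≤ n - E.card by omega) (Nat.sub_le n E.card),
      Nat.cast_sub (by omega)]
    ring

end Dimension

/-! ### Schemes given by homomorphisms from a finite group -/

namespace SecretSharingScheme

section OfHoms

variable {P : Type u} {Ω G : Type} {H : P → Type} [AddCommGroup Ω] [Fintype Ω] [AddCommGroup G]
  [Fintype G] [∀ p, AddCommGroup (H p)] [∀ p, Fintype (H p)]

/-- The scheme in which the secret and the shares are homomorphic images of a uniformly distributed
element of a finite group. -/
noncomputable def ofHoms (f : Ω →+ G) (g : ∀ p, Ω →+ H p) : SecretSharingScheme P where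
  Ω := Ω
  weight _ := 1 / Fintype.card Ω
  weight_nonneg _ := by positivity
  sum_weight := by
    have : (Fintype.card Ω : ℝ) ≠ 0 := by exact_mod_cast Fintype.card_ne_zero
    simp [this]
  Secret := G
  Share := H
  secret := f
  share p := g p

variable (f : Ω →+ G) (g : ∀ p, Ω →+ H p)

lemma prob_ofHoms (E : Set Ω) : (ofHoms f g).prob E = Nat.card E / Fintype.card Ω := by
  classical
  change ∑ ω : Ω, E.indicator (fun _ => 1 / (Fintype.card Ω : ℝ)) ω = _
  rw [Finset.sum_indicator_eq_sum_filter, Finset.sum_const, nsmul_eq_mul, mul_one_div,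
    Nat.subtype_card (p := (· ∈ E)) (Finset.univ.filter (· ∈ E)) (by simp)]

lemma card_fiber {K : Type*} [AddCommGroup K] [Fintype K] (φ : Ω →+ K)
    (hφ : Function.Surjective φ) (a : K) :
    (Nat.card (φ ⁻¹' {a} : Set Ω) : ℝ) / Fintype.card Ω = 1 / Fintype.card K := by
  have hconst (b : K) : Nat.card (φ ⁻¹' {b} : Set Ω) = Nat.card (φ ⁻¹' {a} : Set Ω) := by
    obtain ⟨ω₀, hω₀⟩ := hφ (b - a)
    refine Nat.card_congr ((Equiv.subRight ω₀).subtypeEquiv fun ω => ?_)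
    simp only [Set.mem_preimage, Set.mem_singleton_iff, Equiv.subRight_apply, map_sub, hω₀,
      sub_eq_iff_eq_add, add_sub_cancel]
  have hsum : Fintype.card Ω = Fintype.card K * Nat.card (φ ⁻¹' {a} : Set Ω) := by
    rw [← Nat.card_eq_fintype_card, ← Nat.card_congr (Equiv.sigmaFiberEquiv φ), Nat.card_sigma]
    exact (Finset.sum_congr rfl fun b _ => hconst b).trans (by simp)
  have h1 : (Fintype.card Ω : ℝ) ≠ 0 := by exact_mod_cast Fintype.card_ne_zero
  have h2 : (Fintype.card K : ℝ) ≠ 0 := by exact_mod_cast Fintype.card_ne_zero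
  rw [div_eq_div_iff h1 h2, one_mul, hsum]
  push_cast
  ring

/-- A surjective homomorphic image of a uniformly distributed element is uniformly distributed. -/
lemma entropy_ofHoms {K : Type*} [AddCommGroup K] [Fintype K] (φ : Ω →+ K)
    (hφ : Function.Surjective φ) :
    (ofHoms f g).entropy (α := K) (fun ω : Ω => φ ω) = Real.log (Fintype.card K) := by
  have h2 : (Fintype.card K : ℝ) ≠ 0 := by exact_mod_cast Fintype.card_ne_zero
  unfold entropy
  have h (a : K) : (ofHoms f g).prob ((fun ω : Ω => φ ω) ⁻¹' {a}) = 1 / Fintype.card K := by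
    rw [← card_fiber φ hφ a]
    exact prob_ofHoms f g _
  rw [Finset.sum_congr rfl fun a _ => by rw [h a], Finset.sum_const, nsmul_eq_mul,
    Finset.card_univ, Real.negMulLog, one_div, Real.log_inv]
  field_simp

lemma recovers_ofHoms {B : Set P} (h : ∀ ω, (∀ p ∈ B, g p ω = 0) → f ω = 0) :
    (ofHoms f g).Recovers B := by
  intro (ω : Ω) (ω' : Ω) _ _ heq
  change f ω = f ω'
  rw [← sub_eq_zero, ← map_sub]
  refine h _ fun p hp => ?_
  rw [map_sub, sub_eq_zero]
  exact congrFun heq ⟨p, hp⟩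

/-- If any secret is compatible with zero shares of `B`, then translations show that the shares of
`B` are independent of the secret. -/
lemma noInformation_ofHoms {B : Set P} (h : ∀ s, ∃ ω, (∀ p ∈ B, g p ω = 0) ∧ f ω = s) :
    (ofHoms f g).NoInformation B := by
  intro (s : G) (x : ∀ p : B, H p)
  let sh : Ω → ∀ p : B, H p := fun ω p => g p ω
  have hsurj : Function.Surjective f := fun s => (h s).imp fun _ hω => hω.2
  have hconst (a : G) : Nat.card ({ω | f ω = a ∧ sh ω = x} : Set Ω) =
      Nat.card ({ω | f ω = s ∧ sh ω = x} : Set Ω) := by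
    obtain ⟨ω₀, h0, hω₀⟩ := h (a - s)
    refine Nat.card_congr ((Equiv.subRight ω₀).subtypeEquiv fun ω => ?_)
    have hsh : sh (ω - ω₀) = sh ω := by
      funext p
      simp only [sh, map_sub, h0 p p.2, sub_zero]
    simp only [Set.mem_ofPred_eq, Equiv.subRight_apply, hsh, map_sub, hω₀, sub_eq_iff_eq_add,
      add_sub_cancel]
  have hsum : Nat.card (sh ⁻¹' {x} : Set Ω) =
      Fintype.card G * Nat.card ({ω | f ω = s ∧ sh ω = x} : Set Ω) := by
    rw [← Nat.card_congr (Equiv.sigmaFiberEquiv fun ω : (sh ⁻¹' {x} : Set Ω) => f ω.1),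
      Nat.card_sigma, Finset.sum_congr rfl fun a _ => ?_, Finset.sum_const, smul_eq_mul,
      Finset.card_univ]
    rw [← hconst a]
    exact Nat.card_congr ((Equiv.subtypeSubtypeEquivSubtypeInter (fun ω => sh ω = x)
      fun ω => f ω = a).trans (Equiv.subtypeEquivRight fun ω => and_comm))
  have e1 := prob_ofHoms f g (f ⁻¹' {s} ∩ sh ⁻¹' {x})
  have e2 := prob_ofHoms f g (f ⁻¹' {s})
  have e3 := prob_ofHoms f g (sh ⁻¹' {x})
  refine e1.trans (Eq.trans ?_ (congrArg₂ (· * ·) e2 e3).symm)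
  simp only [card_fiber f hsurj s, hsum]
  have h2 : (Fintype.card G : ℝ) ≠ 0 := by exact_mod_cast Fintype.card_ne_zero
  push_cast
  field_simp
  rfl

end OfHoms

lemma relativeSize_nonneg {P : Type u} (S : SecretSharingScheme P) (p : P) :
    0 ≤ S.relativeSize p := by
  have hprob (E : Set S.Ω) : 0 ≤ S.prob E ∧ S.prob E ≤ 1 := by
    refine ⟨Finset.sum_nonneg fun ω _ => Set.indicator_nonneg (fun ω _ => S.weight_nonneg ω) ω, ?_⟩
    rw [← S.sum_weight]
    exact Finset.sum_le_sum fun ω _ => Set.indicator_le_self' (fun ω _ => S.weight_nonneg ω) ω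
  have hent {α : Type} [Fintype α] (X : S.Ω → α) : 0 ≤ S.entropy X :=
    Finset.sum_nonneg fun a _ => Real.negMulLog_nonneg (hprob _).1 (hprob _).2
  exact div_nonneg (hent _) (hent _)

end SecretSharingScheme

lemma accessComplexity_le {P : Type u} {Γ : UpperSet (Set P)} (S : SecretSharingScheme P)
    (hS : S.Realizes Γ) : accessComplexity Γ ≤ S.complexity := by
  refine csInf_le ⟨0, ?_⟩ ⟨S, hS, rfl⟩
  rintro _ ⟨T, -, rfl⟩
  exact Real.iSup_nonneg T.relativeSize_nonneg

/-! ### The linear scheme -/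

section LinearScheme

variable {n k : ℕ}

/-- The joint shares: families of shares whose sum lies in the space of secrets. -/
def jointShares (E : Fin k → Finset (Fin n)) :
    Submodule (ZMod 2) (Fin k → FullWord n → ZMod 2) where
  carrier := {x | (∀ p, x p ∈ shareSpace (E p)) ∧ ∑ p, x p ∈ shareSpace Finset.univ}
  add_mem' := fun hx hy => ⟨fun p => add_mem (hx.1 p) (hy.1 p), by
    simpa [Finset.sum_add_distrib] using add_mem hx.2 hy.2⟩
  zero_mem' := ⟨fun _ => zero_mem _, by simp⟩
  smul_mem' := fun c x hx => ⟨fun p => Submodule.smul_mem _ c (hx.1 p), by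
    simpa [← Finset.smul_sum] using Submodule.smul_mem _ c hx.2⟩

/-- The share of `p`. -/
def jointShares.share (E : Fin k → Finset (Fin n)) (p : Fin k) :
    jointShares E →+ shareSpace (E p) where
  toFun x := ⟨x.1 p, x.2.1 p⟩
  map_zero' := rfl
  map_add' _ _ := rfl

/-- The secret: the sum of all shares. -/
def jointShares.secret (E : Fin k → Finset (Fin n)) :
    jointShares E →+ shareSpace (Finset.univ : Finset (Fin n)) where
  toFun x := ⟨∑ p, x.1 p, x.2.2⟩
  map_zero' := by ext; simp
  map_add' _ _ := by ext; simp [Finset.sum_add_distrib]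

/-- Zero shares of all participants whose index set contains `i` force the secret to be zero, for
the other shares vanish at the words beginning with `i`. -/
lemma jointShares.secret_eq_zero {E : Fin k → Finset (Fin n)} (i : Fin n) (x : jointShares E)
    (hx : ∀ p, i ∈ E p → jointShares.share E p x = 0) : jointShares.secret E x = 0 := by
  refine Subtype.ext (eq_zero_of_mem_shareSpace_univ x.2.2 i fun σ hσ => ?_)
  change (∑ p, x.1 p) σ = 0
  rw [Finset.sum_apply]
  refine Finset.sum_eq_zero fun p _ => ?_
  by_cases hp : i ∈ E p
  · exact congrFun (congrArg Subtype.val (hx p hp)) σ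
  · refine shareSpace_apply_eq_zero (x.2.1 p) (fun a ha => ?_) σ.2
    rw [hσ] at ha
    obtain rfl : i = a := by simpa using ha
    exact hp

/-- Any secret is compatible with zero shares of the participants outside a cover `C`. -/
lemma jointShares.exists_secret_eq {E : Fin k → Finset (Fin n)} (hn : 1 ≤ n) (C : Finset (Fin k))
    (hC : ∀ i, ∃ p ∈ C, i ∈ E p) (s : shareSpace (Finset.univ : Finset (Fin n))) :
    ∃ x, (∀ p ∉ C, jointShares.share E p x = 0) ∧ jointShares.secret E x = s := by
  obtain ⟨x, hx, hx0, hs⟩ := exists_shares_sum_eq E C hn hC s.2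
  exact ⟨⟨x, hx, hs ▸ s.2⟩, fun p hp => Subtype.ext (hx0 p hp), Subtype.ext hs⟩

/-- Every share occurs: the difference between the secret and the given share can be distributed
among participants of level one. If the participant in question is itself of level one, then the
secret is chosen to extend its share. -/
lemma jointShares.share_surjective {E : Fin k → Finset (Fin n)} (hn : 1 ≤ n)
    (hE : ∀ i, ∃ p, E p = {i}) (p : Fin k) : Function.Surjective (jointShares.share E p) := by
  classical
  rintro ⟨x, hx⟩
  choose q hq using hE
  have hqinj : Function.Injective q := fun i j hij =>
    Finset.singleton_injective (by rw [← hq i, ← hq j, hij])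
  obtain ⟨s, hs, hsx⟩ : ∃ s ∈ shareSpace (Finset.univ : Finset (Fin n)),
      ∀ i, q i = p → ∀ σ : FullWord n, σ.1.head? = some i → s σ = x σ := by
    by_cases h : ∃ i, q i = p
    · obtain ⟨i, rfl⟩ := h
      obtain ⟨s, hs, hsx⟩ := exists_mem_shareSpace_univ_eq i x
      exact ⟨s, hs, fun j hj => hqinj hj ▸ hsx⟩
    · exact ⟨0, zero_mem _, fun i hi => absurd ⟨i, hi⟩ h⟩
  let part (i : Fin n) : FullWord n → ZMod 2 :=
    fun σ => if σ.1.head? = some i then s σ - x σ else 0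
  have hpart (i : Fin n) : part i ∈ shareSpace {i} :=
    mem_shareSpace_singleton fun σ hσ => if_neg hσ
  have hpart0 (i : Fin n) (hi : q i = p) : part i = 0 := by
    funext σ
    by_cases hσ : σ.1.head? = some i
    · simp only [part, if_pos hσ, hsx i hi σ hσ, sub_self, Pi.zero_apply]
    · exact if_neg hσ
  have hsum : ∑ i, part i = s - x := by
    funext σ
    obtain ⟨a, v, hσ⟩ : ∃ a v, σ.1 = a :: v := by
      refine List.exists_cons_of_length_pos ?_
      rw [σ.2.length_eq, List.length_finRange]
      exact hn
    rw [Finset.sum_apply, Finset.sum_eq_single a]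
    · simp [part, hσ]
    · intro b _ hb
      exact if_neg (by simpa [hσ] using hb.symm)
    · simp
  let y : Fin k → FullWord n → ZMod 2 :=
    (Pi.single p x : Fin k → FullWord n → ZMod 2) + ∑ i, Pi.single (q i) (part i)
  have hyp (r : Fin k) : y r = (if r = p then x else 0) + ∑ i, if r = q i then part i else 0 := by
    simp only [y, Pi.add_apply, Finset.sum_apply, Pi.single_apply]
  have hy1 (r : Fin k) : y r ∈ shareSpace (E r) := by
    rw [hyp]
    refine add_mem ?_ (sum_mem fun i _ => ?_)
    · split_ifs with h
      · exact h ▸ hx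
      · exact zero_mem _
    · split_ifs with h
      · rw [h, hq]
        exact hpart i
      · exact zero_mem _
  have hy2 : ∑ r, y r = s := by
    simp only [hyp, Finset.sum_add_distrib]
    rw [Finset.sum_comm]
    simp [hsum]
  refine ⟨⟨y, hy1, hy2.symm ▸ hs⟩, Subtype.ext ?_⟩
  change y p = x
  rw [hyp, if_pos rfl, Finset.sum_eq_zero, add_zero]
  intro i _
  split_ifs with h
  · exact hpart0 i h.symm
  · rfl

end LinearScheme

/-! ### Realizing access structures -/

section Realization

variable {P : Type u}

/-- The indices of the minimal qualified sets containing `p`. -/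
noncomputable def memIndices {n : ℕ} {Γ : UpperSet (Set P)} (e : minimalQualified Γ ≃ Fin n)
    (p : P) : Finset (Fin n) := by
  classical exact Finset.univ.filter fun i => p ∈ (e.symm i).1

lemma mem_memIndices {n : ℕ} {Γ : UpperSet (Set P)} {e : minimalQualified Γ ≃ Fin n} {p : P}
    {i : Fin n} : i ∈ memIndices e p ↔ p ∈ (e.symm i).1 := by
  simp [memIndices]

lemma card_memIndices {n : ℕ} {Γ : UpperSet (Set P)} (e : minimalQualified Γ ≃ Fin n) (p : P) :
    (memIndices e p).card = level Γ p := by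
  rw [level, ← Nat.card_coe_set_eq, ← Nat.subtype_card (p := (· ∈ memIndices e p)) _ fun i => Iff.rfl]
  refine Nat.card_congr ((e.symm.subtypeEquiv fun i => mem_memIndices).trans
    (Equiv.subtypeSubtypeEquivSubtypeInter (· ∈ minimalQualified Γ) fun A => p ∈ A))

/-- An access structure in which every minimal qualified set has a participant belonging to no
other minimal qualified set is realized by a perfect scheme with relative share sizes `f_n`. -/
lemma exists_realizes_relativeSize_eq {n : ℕ} (hn : 1 ≤ n) [Finite P] {Γ : UpperSet (Set P)}
    (hΓ : (minimalQualified Γ).ncard = n)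
    (hsingle : ∀ A ∈ minimalQualified Γ, (participantClass Γ {A}).Nonempty) :
    ∃ S : SecretSharingScheme P, S.Realizes Γ ∧
      ∀ p, S.relativeSize p = shareSize n (level Γ p) := by
  classical
  obtain ⟨k, ⟨ν⟩⟩ := Finite.exists_equiv_fin P
  let e : minimalQualified Γ ≃ Fin n := Finite.equivFinOfCardEq (by rw [Nat.card_coe_set_eq, hΓ])
  let E : Fin k → Finset (Fin n) := fun j => memIndices e (ν.symm j)
  have hE (i : Fin n) : ∃ j, E j = {i} := by
    obtain ⟨p, hp⟩ := hsingle (e.symm i).1 (e.symm i).2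
    refine ⟨ν p, ?_⟩
    ext j
    rw [show E (ν p) = memIndices e p by simp [E], mem_memIndices, hp _ (e.symm j).2]
    simp [Subtype.val_inj]
  let _ : Fintype (jointShares E) := Fintype.ofFinite _
  let _ : ∀ F : Finset (Fin n), Fintype (shareSpace F) := fun F => Fintype.ofFinite _
  let S : SecretSharingScheme P := SecretSharingScheme.ofHoms (H := fun p => shareSpace (E (ν p)))
    (jointShares.secret E) (fun p => jointShares.share E (ν p))
  have hlog (F : Finset (Fin n)) : Real.log (Fintype.card (shareSpace F)) =
      shareSize n F.card * (n - 1).factorial * Real.log 2 := by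
    rw [← Nat.card_eq_fintype_card, card_shareSpace, ← shareDim_eq F hn]
    simp
  have hsurj : Function.Surjective (jointShares.secret E) := fun s => by
    obtain ⟨x, -, hx⟩ := jointShares.exists_secret_eq (E := E) hn Finset.univ
      (fun i => (hE i).imp fun j (hj : E j = {i}) => ⟨Finset.mem_univ _, by rw [hj]; simp⟩) s
    exact ⟨x, hx⟩
  have hsec : S.entropy S.secret = (n - 1).factorial * Real.log 2 := by
    refine (SecretSharingScheme.entropy_ofHoms _ _ _ hsurj).trans ?_
    rw [hlog]
    simp [shareSize]
  have hshare (p : P) : S.entropy (S.share p) =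
      shareSize n (level Γ p) * (n - 1).factorial * Real.log 2 := by
    refine (SecretSharingScheme.entropy_ofHoms _ _ _
      (jointShares.share_surjective hn hE (ν p))).trans ?_
    rw [hlog, ← card_memIndices e p]
    simp [E]
  have hfac : (0 : ℝ) < (n - 1).factorial := by exact_mod_cast Nat.factorial_pos _
  have hlog2 : (0 : ℝ) < Real.log 2 := Real.log_pos (by norm_num)
  refine ⟨S, ⟨?_, fun B hB => ?_, fun B hB => ?_⟩, fun p => ?_⟩
  · rw [hsec]
    positivity
  · obtain ⟨A, hAB, hA⟩ := exists_minimal_le_of_wellFoundedLT (· ∈ Γ) B hB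
    refine SecretSharingScheme.recovers_ofHoms _ _ fun x hx => ?_
    refine jointShares.secret_eq_zero (e ⟨A, hA⟩) x fun j hj => ?_
    have hjA : ν.symm j ∈ A := by simpa [E, mem_memIndices] using hj
    have := hx (ν.symm j) (hAB hjA)
    rwa [ν.apply_symm_apply] at this
  · refine SecretSharingScheme.noInformation_ofHoms _ _ fun s => ?_
    have hcover (i : Fin n) : ∃ j ∈ Finset.univ.filter fun j => ν.symm j ∉ B, i ∈ E j := by
      obtain ⟨p, hpA, hpB⟩ : ∃ p ∈ (e.symm i).1, p ∉ B :=
        Set.not_subset.mp fun hsub => hB (Γ.upper hsub (e.symm i).2.prop)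
      exact ⟨ν p, by simpa using hpB, by simpa [E, mem_memIndices] using hpA⟩
    obtain ⟨x, hx, hxs⟩ := jointShares.exists_secret_eq hn _ hcover s
    exact ⟨x, fun p hp => hx (ν p) (by simpa using hp), hxs⟩
  · rw [SecretSharingScheme.relativeSize, hshare, hsec]
    field_simp

end Realization

/-! ### The asymptotic value of the largest share size -/

section Analysis

lemma shareSize_of_lt {n i : ℕ} (hi : i < n) :
    shareSize n i = ((n : ℝ) - i) * ∑ j ∈ Finset.Ico (n - i) n, 1 / (j : ℝ) := by
  rw [shareSize, if_neg hi.ne, harmonicBelow, harmonicBelow,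
    ← Finset.sum_Ico_consecutive _ (show 1 ≤ n - i by omega) (Nat.sub_le n i), add_sub_cancel_left]

/-- The largest share size in terms of the number `r` of minimal qualified sets that avoid the
participant. -/
lemma shareSize_sub {n r : ℕ} (hr : 1 ≤ r) (hrn : r ≤ n) :
    shareSize n (n - r) = r * ∑ j ∈ Finset.Ico r n, 1 / (j : ℝ) := by
  rw [shareSize_of_lt (by omega), Nat.sub_sub_self hrn, Nat.cast_sub hrn, sub_sub_cancel]

lemma shareSize_le_maxShareSize {n i : ℕ} (hi : 1 ≤ i) (hin : i < n) :
    shareSize n i ≤ maxShareSize n :=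
  le_ciSup (f := fun i : Finset.Ico 1 n => shareSize n i) (Set.finite_range _).bddAbove
    ⟨i, Finset.mem_Ico.mpr ⟨hi, hin⟩⟩

lemma exists_maxShareSize_eq {n : ℕ} (hn : 2 ≤ n) :
    ∃ i, 1 ≤ i ∧ i < n ∧ maxShareSize n = shareSize n i := by
  have : Nonempty (Finset.Ico 1 n) := ⟨⟨1, Finset.mem_Ico.mpr ⟨le_rfl, hn⟩⟩⟩
  obtain ⟨⟨i, hi⟩, h⟩ := exists_eq_ciSup_of_finite (f := fun i : Finset.Ico 1 n => shareSize n i)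
  exact ⟨i, (Finset.mem_Ico.mp hi).1, (Finset.mem_Ico.mp hi).2, h.symm⟩

lemma shareSize_one {n : ℕ} (hn : 2 ≤ n) : shareSize n 1 = 1 := by
  rw [shareSize_of_lt (by omega)]
  obtain ⟨m, rfl⟩ : ∃ m, n = m + 1 := ⟨n - 1, by omega⟩
  have : (m : ℝ) ≠ 0 := by
    have : m ≠ 0 := by omega
    exact_mod_cast this
  simp [this]

lemma shareSize_zero {n : ℕ} (hn : 1 ≤ n) : shareSize n 0 = 0 := by
  rw [shareSize_of_lt (by omega)]
  simp

lemma shareSize_self (n : ℕ) : shareSize n n = 1 := if_pos rfl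

/-- The trapezoid rule overestimates the integral of `1 / t` over `[1, 1 + x]`. -/
lemma log_one_add_le {x : ℝ} (hx : 0 ≤ x) : Real.log (1 + x) ≤ x / 2 + x / (2 * (1 + x)) := by
  have hderiv (y : ℝ) (hy : 0 ≤ y) :
      HasDerivAt (fun x : ℝ => x / 2 + x / (2 * (1 + x)) - Real.log (1 + x))
        (y ^ 2 / (2 * (1 + y) ^ 2)) y := by
    have h1 : HasDerivAt (fun x : ℝ => 1 + x) 1 y := (hasDerivAt_id y).const_add 1
    have h := (((hasDerivAt_id y).div_const 2).add
      ((hasDerivAt_id y).div (h1.const_mul 2) (by positivity))).sub (h1.log (by positivity))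
    refine h.congr_deriv ?_
    have : 1 + y ≠ 0 := by positivity
    simp only [id]
    field_simp
    ring
  have hmono : MonotoneOn (fun x : ℝ => x / 2 + x / (2 * (1 + x)) - Real.log (1 + x))
      (Set.Ici 0) := by
    refine monotoneOn_of_deriv_nonneg (convex_Ici 0)
      (fun y hy => (hderiv y hy).continuousAt.continuousWithinAt) (fun y hy => ?_) fun y hy => ?_
    · rw [interior_Ici] at hy
      exact (hderiv y (le_of_lt hy)).differentiableAt.differentiableWithinAt
    · rw [interior_Ici] at hy
      rw [(hderiv y (le_of_lt hy)).deriv]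
      positivity
  have := hmono (Set.mem_Ici.mpr le_rfl) (Set.mem_Ici.mpr hx) hx
  simp only [zero_div, add_zero, Real.log_one, sub_zero] at this
  linarith

/-- The trapezoid rule with its first Euler–Maclaurin correction underestimates the integral of
`1 / t` over `[1, 1 + x]`. -/
lemma le_log_one_add {x : ℝ} (hx : 0 ≤ x) :
    x / 2 + x / (2 * (1 + x)) - (x ^ 2 - x ^ 2 / (1 + x) ^ 2) / 12 ≤ Real.log (1 + x) := by
  have hderiv (y : ℝ) (hy : 0 ≤ y) :
      HasDerivAt (fun x : ℝ => Real.log (1 + x) -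
          (x / 2 + x / (2 * (1 + x)) - (x ^ 2 - x ^ 2 / (1 + x) ^ 2) / 12))
        (y ^ 4 / (6 * (1 + y) ^ 3)) y := by
    have h1 : HasDerivAt (fun x : ℝ => 1 + x) 1 y := (hasDerivAt_id y).const_add 1
    have hsq : HasDerivAt (fun x : ℝ => x ^ 2) (2 * y) y := by simpa using hasDerivAt_pow 2 y
    have h1sq : HasDerivAt (fun x : ℝ => (1 + x) ^ 2) (2 * (1 + y)) y := by simpa using h1.fun_pow 2
    have h := (h1.log (by positivity)).sub ((((hasDerivAt_id y).div_const 2).add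
      ((hasDerivAt_id y).div (h1.const_mul 2) (by positivity))).sub
        ((hsq.sub (hsq.div h1sq (by positivity))).div_const 12))
    refine h.congr_deriv ?_
    have : 1 + y ≠ 0 := by positivity
    simp only [id]
    field_simp
    ring
  have hmono : MonotoneOn (fun x : ℝ => Real.log (1 + x) -
      (x / 2 + x / (2 * (1 + x)) - (x ^ 2 - x ^ 2 / (1 + x) ^ 2) / 12)) (Set.Ici 0) := by
    refine monotoneOn_of_deriv_nonneg (convex_Ici 0)
      (fun y hy => (hderiv y hy).continuousAt.continuousWithinAt) (fun y hy => ?_) fun y hy => ?_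
    · rw [interior_Ici] at hy
      exact (hderiv y (le_of_lt hy)).differentiableAt.differentiableWithinAt
    · rw [interior_Ici] at hy
      have hy' : (0 : ℝ) ≤ y := le_of_lt hy
      rw [(hderiv y hy').deriv]
      positivity
  have := hmono (Set.mem_Ici.mpr le_rfl) (Set.mem_Ici.mpr hx) hx
  norm_num at this
  linarith

lemma log_succ_sub_log {j : ℕ} (hj : 1 ≤ j) :
    Real.log ((j + 1 : ℕ) : ℝ) - Real.log j = Real.log (1 + 1 / (j : ℝ)) := by
  have : (0 : ℝ) < j := by exact_mod_cast hj
  rw [← Real.log_div (by positivity) this.ne']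
  congr 1
  push_cast
  field_simp

lemma le_sum_Ico_inv {r n : ℕ} (hr : 1 ≤ r) (hrn : r ≤ n) :
    Real.log n - 1 / (2 * n) - (Real.log r - 1 / (2 * r)) ≤
      ∑ j ∈ Finset.Ico r n, 1 / (j : ℝ) := by
  rw [← Finset.sum_Ico_sub (fun j : ℕ => Real.log j - 1 / (2 * j)) hrn]
  refine Finset.sum_le_sum fun j hj => ?_
  have hj1 : 1 ≤ j := hr.trans (Finset.mem_Ico.mp hj).1
  have hjpos : (0 : ℝ) < j := by exact_mod_cast hj1
  have h := log_one_add_le (x := 1 / (j : ℝ)) (by positivity)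
  rw [← log_succ_sub_log hj1] at h
  have e : 1 / (j : ℝ) / 2 + 1 / (j : ℝ) / (2 * (1 + 1 / (j : ℝ))) =
      1 / j + (1 / (2 * ((j + 1 : ℕ) : ℝ)) - 1 / (2 * j)) := by
    push_cast
    field_simp
    ring
  linarith

lemma sum_Ico_inv_le {r n : ℕ} (hr : 1 ≤ r) (hrn : r ≤ n) :
    ∑ j ∈ Finset.Ico r n, 1 / (j : ℝ) ≤
      Real.log n - 1 / (2 * n) - 1 / (12 * n ^ 2) -
        (Real.log r - 1 / (2 * r) - 1 / (12 * r ^ 2)) := by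
  have := Finset.sum_Ico_sub
    (fun j : ℕ => Real.log j - 1 / (2 * (j : ℝ)) - 1 / (12 * (j : ℝ) ^ 2)) hrn
  rw [← this]
  refine Finset.sum_le_sum fun j hj => ?_
  have hj1 : 1 ≤ j := hr.trans (Finset.mem_Ico.mp hj).1
  have hjpos : (0 : ℝ) < j := by exact_mod_cast hj1
  have h := le_log_one_add (x := 1 / (j : ℝ)) (by positivity)
  rw [← log_succ_sub_log hj1] at h
  have e : 1 / (j : ℝ) / 2 + 1 / (j : ℝ) / (2 * (1 + 1 / (j : ℝ))) -
      ((1 / (j : ℝ)) ^ 2 - (1 / (j : ℝ)) ^ 2 / (1 + 1 / (j : ℝ)) ^ 2) / 12 =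
      1 / j + (1 / (2 * ((j + 1 : ℕ) : ℝ)) + 1 / (12 * ((j + 1 : ℕ) : ℝ) ^ 2)
        - 1 / (2 * j) - 1 / (12 * (j : ℝ) ^ 2)) := by
    push_cast
    field_simp
    ring
  linarith

/-- At the maximum of `r ↦ r ∑_{r ≤ j < n} 1 / j` one has `n ≤ e (r + 1)`, as replacing `r` by
`r + 1` changes the value by `∑_{r < j < n} 1 / j - 1`. -/
lemma le_exp_mul_of_isMax {n r : ℕ} (hr : 1 ≤ r) (hrn : r < n)
    (hmax : ∀ r', 1 ≤ r' → r' < n →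
      (r' : ℝ) * ∑ j ∈ Finset.Ico r' n, 1 / (j : ℝ) ≤ r * ∑ j ∈ Finset.Ico r n, 1 / (j : ℝ)) :
    (n : ℝ) ≤ Real.exp 1 * (r + 1) := by
  have hrpos : (0 : ℝ) < r := by exact_mod_cast hr
  have hsum : ∑ j ∈ Finset.Ico (r + 1) n, 1 / (j : ℝ) ≤ 1 := by
    rcases Nat.lt_or_ge (r + 1) n with h | h
    · have h1 := hmax (r + 1) (by omega) h
      rw [Finset.sum_eq_sum_Ico_succ_bot hrn, mul_add, mul_one_div_cancel hrpos.ne'] at h1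
      push_cast at h1
      linarith
    · rw [Finset.Ico_eq_empty (by omega)]
      simp
  have hlog := le_sum_Ico_inv (r := r + 1) (n := n) (by omega) hrn
  have hn : (0 : ℝ) < n := by exact_mod_cast (by omega : 0 < n)
  have hle : ((r + 1 : ℕ) : ℝ) ≤ n := by exact_mod_cast hrn
  have hinv : 1 / (2 * (n : ℝ)) ≤ 1 / (2 * ((r + 1 : ℕ) : ℝ)) := by gcongr
  have h2 : Real.log n ≤ Real.log (Real.exp 1 * (r + 1)) := by
    rw [Real.log_mul (by positivity) (by positivity), Real.log_exp]
    push_cast at hlog hinv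
    linarith
  exact (Real.log_le_log_iff hn (by positivity)).mp h2

lemma exp_neg_le_quadratic {v : ℝ} (hv : 0 ≤ v) : Real.exp (-v) ≤ 1 - v + v ^ 2 / 2 := by
  have h := Real.quadratic_le_exp_of_nonneg hv
  rw [Real.exp_neg]
  refine inv_le_of_inv_le₀ (by nlinarith [sq_nonneg (v - 1)]) ?_
  refine le_trans ?_ h
  rw [inv_le_iff_one_le_mul₀ (by nlinarith [sq_nonneg (v - 1)])]
  nlinarith [sq_nonneg (v ^ 2)]

/-- The bound `t ≤ e ^ (t - 1)` for `t = log (y / r)` estimates the value at `r` by `y / e` and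
a term depending only on `r`. -/
lemma mul_sum_Ico_inv_le {n r : ℕ} (hr : 1 ≤ r) (hrn : r ≤ n) :
    r * ∑ j ∈ Finset.Ico r n, 1 / (j : ℝ) ≤
      n * (1 - (1 / (2 * n) + 1 / (12 * n ^ 2)) + (1 / (2 * n) + 1 / (12 * n ^ 2)) ^ 2 / 2)
        / Real.exp 1 + 1 / 2 + 1 / (12 * r) := by
  have hrpos : (0 : ℝ) < r := by exact_mod_cast hr
  have hn : (0 : ℝ) < n := by exact_mod_cast hr.trans hrn
  set v : ℝ := 1 / (2 * n) + 1 / (12 * n ^ 2) with hv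
  have hv0 : 0 ≤ v := by positivity
  have h1 := mul_le_mul_of_nonneg_left (sum_Ico_inv_le hr hrn) hrpos.le
  have h2 : Real.log n - v - Real.log r ≤ n * Real.exp (-v) / (Real.exp 1 * r) := by
    have h := Real.add_one_le_exp (Real.log n - v - Real.log r - 1)
    rw [Real.exp_sub, Real.exp_sub, sub_eq_add_neg _ v, Real.exp_add, Real.exp_log hn,
      Real.exp_log hrpos, div_div, mul_comm (r : ℝ)] at h
    linarith
  have h3 : r * (Real.log n - v - Real.log r) ≤ n * Real.exp (-v) / Real.exp 1 := by
    refine (mul_le_mul_of_nonneg_left h2 hrpos.le).trans_eq ?_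
    field_simp
  have h4 : n * Real.exp (-v) / Real.exp 1 ≤ n * (1 - v + v ^ 2 / 2) / Real.exp 1 := by
    have := exp_neg_le_quadratic hv0
    gcongr
  have e : (r : ℝ) * (Real.log n - 1 / (2 * n) - 1 / (12 * n ^ 2) -
        (Real.log r - 1 / (2 * r) - 1 / (12 * r ^ 2))) =
      r * (Real.log n - v - Real.log r) + 1 / 2 + 1 / (12 * r) := by
    rw [hv]
    field_simp
    ring
  linarith

/-- The upper bound for large `n`, from the estimate of the value at `r` and `r ≥ n / e - 1`. -/
lemma maxShareSize_lt_of_ten_le {n : ℕ} (hn : 10 ≤ n) :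
    maxShareSize n <
      (n : ℝ) / Real.exp 1 + (Real.exp 1 - 1) / (2 * Real.exp 1) + 1 / (3 * (n : ℝ)) := by
  obtain ⟨i, hi1, hin, hmax⟩ := exists_maxShareSize_eq (n := n) (by omega)
  obtain ⟨r, hr, hrn, rfl⟩ : ∃ r, 1 ≤ r ∧ r < n ∧ i = n - r := ⟨n - i, by omega, by omega, by omega⟩
  have hexp : (n : ℝ) ≤ Real.exp 1 * (r + 1) := by
    refine le_exp_mul_of_isMax hr hrn fun r' hr' hr'n => ?_
    rw [← shareSize_sub hr' hr'n.le, ← shareSize_sub hr hrn.le, ← hmax]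
    exact shareSize_le_maxShareSize (by omega) (by omega)
  rw [hmax, shareSize_sub hr hrn.le]
  refine (mul_sum_Ico_inv_le hr hrn.le).trans_lt ?_
  have he1 := Real.exp_one_gt_d9
  have he2 := Real.exp_one_lt_d9
  set e := Real.exp 1
  have hn' : (10 : ℝ) ≤ n := by exact_mod_cast hn
  have hrpos : (0 : ℝ) < r := by exact_mod_cast hr
  have hmain : (n : ℝ) * (1 - (1 / (2 * n) + 1 / (12 * n ^ 2)) +
      (1 / (2 * n) + 1 / (12 * n ^ 2)) ^ 2 / 2) ≤ n - 1 / 2 + 46 / (1000 * n) := by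
    have : (n : ℝ) - 1 / 2 + 46 / (1000 * n) - n * (1 - (1 / (2 * n) + 1 / (12 * n ^ 2)) +
      (1 / (2 * n) + 1 / (12 * n ^ 2)) ^ 2 / 2) =
        (1560 * n ^ 2 - 15000 * n - 1250) / (360000 * n ^ 3) := by
      field_simp
      ring
    have h2 : 0 ≤ (1560 * (n : ℝ) ^ 2 - 15000 * n - 1250) / (360000 * n ^ 3) :=
      div_nonneg (by nlinarith) (by positivity)
    linarith
  have hr3 : (3 : ℝ) ≤ r := by
    have : 2 < r := by
      by_contra h
      have : (r : ℝ) ≤ 2 := by exact_mod_cast not_lt.mp h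
      nlinarith
    exact_mod_cast this
  -- `n ≤ e (r + 1) ≤ (4 / 3) e r`, and `e / 9 < 0.3021`
  have hr' : 1 / (12 * (r : ℝ)) ≤ 3021 / (10000 * n) := by
    rw [div_le_div_iff₀ (by positivity) (by positivity)]
    nlinarith
  have hmain' : (n : ℝ) * (1 - (1 / (2 * n) + 1 / (12 * n ^ 2)) +
      (1 / (2 * n) + 1 / (12 * n ^ 2)) ^ 2 / 2) / e ≤ (n - 1 / 2 + 46 / (1000 * n)) / e := by
    gcongr
  have h46 : 46 / (1000 * n) / e ≤ 46 / (2000 * (n : ℝ)) := by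
    rw [div_div, show 2000 * (n : ℝ) = 1000 * n * 2 by ring]
    gcongr
    linarith
  have hsum : 46 / (2000 * (n : ℝ)) + 3021 / (10000 * n) < 1 / (3 * (n : ℝ)) := by
    rw [div_add_div _ _ (by positivity) (by positivity),
      div_lt_div_iff₀ (by positivity) (by positivity)]
    nlinarith [sq_nonneg (n : ℝ), mul_pos (show (0 : ℝ) < n by linarith)
      (mul_pos (show (0 : ℝ) < n by linarith) (show (0 : ℝ) < n by linarith))]
  have e1 : ((n : ℝ) - 1 / 2 + 46 / (1000 * n)) / e =
      n / e - 1 / (2 * e) + 46 / (1000 * n) / e := by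
    field_simp
  have e2 : (e - 1) / (2 * e) = 1 / 2 - 1 / (2 * e) := by
    field_simp
  rw [e2]
  linarith

/-- The upper bound for small `n`, by evaluating all the share sizes. -/
lemma maxShareSize_lt_of_lt_ten {n : ℕ} (hn : 2 ≤ n) (hn' : n < 10) :
    maxShareSize n <
      (n : ℝ) / Real.exp 1 + (Real.exp 1 - 1) / (2 * Real.exp 1) + 1 / (3 * (n : ℝ)) := by
  obtain ⟨i, hi1, hin, hmax⟩ := exists_maxShareSize_eq hn
  obtain ⟨r, hr, hrn, rfl⟩ : ∃ r, 1 ≤ r ∧ r < n ∧ i = n - r := ⟨n - i, by omega, by omega, by omega⟩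
  rw [hmax, shareSize_sub hr hrn.le]
  have he2 := Real.exp_one_lt_d9
  have hinv : (0.36787944 : ℝ) < 1 / Real.exp 1 := by
    rw [lt_div_iff₀ (Real.exp_pos 1)]
    linarith
  have e1 : (n : ℝ) / Real.exp 1 + (Real.exp 1 - 1) / (2 * Real.exp 1) =
      1 / 2 + (n - 1 / 2) * (1 / Real.exp 1) := by
    field_simp
    ring
  have hn2 : (2 : ℝ) ≤ n := by exact_mod_cast hn
  have hlow : 1 / 2 + ((n : ℝ) - 1 / 2) * 0.36787944 + 1 / (3 * (n : ℝ)) <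
      (n : ℝ) / Real.exp 1 + (Real.exp 1 - 1) / (2 * Real.exp 1) + 1 / (3 * (n : ℝ)) := by
    rw [e1]
    nlinarith
  refine lt_trans ?_ hlow
  clear hlow e1 hmax hi1 hin hn2
  interval_cases n <;> interval_cases r <;> norm_num [Finset.sum_Ico_eq_sum_range,
    Finset.sum_range_succ]

lemma maxShareSize_lt {n : ℕ} (hn : 2 ≤ n) :
    maxShareSize n <
      (n : ℝ) / Real.exp 1 + (Real.exp 1 - 1) / (2 * Real.exp 1) + 1 / (3 * (n : ℝ)) := by
  rcases lt_or_ge n 10 with h | h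
  · exact maxShareSize_lt_of_lt_ten hn h
  · exact maxShareSize_lt_of_ten_le h

lemma bound_lt_div_exp_add_half {n : ℕ} (hn : 2 ≤ n) :
    (n : ℝ) / Real.exp 1 + (Real.exp 1 - 1) / (2 * Real.exp 1) + 1 / (3 * (n : ℝ)) <
      (n : ℝ) / Real.exp 1 + 1 / 2 := by
  have he2 := Real.exp_one_lt_d9
  have hn2 : (2 : ℝ) ≤ n := by exact_mod_cast hn
  have e2 : (Real.exp 1 - 1) / (2 * Real.exp 1) = 1 / 2 - 1 / (2 * Real.exp 1) := by
    field_simp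
  have : 1 / (3 * (n : ℝ)) < 1 / (2 * Real.exp 1) :=
    one_div_lt_one_div_of_lt (by positivity) (by linarith)
  rw [e2]
  linarith

/-- The value at `r = ⌊n / e⌋` is within `O(1 / n)` of the asymptotic value, as the derivative of
`r ↦ r log (n / r)` vanishes at `n / e`. -/
lemma le_maxShareSize {n : ℕ} (hn : 3 ≤ n) :
    (n : ℝ) / Real.exp 1 + (Real.exp 1 - 1) / (2 * Real.exp 1) - Real.exp 1 / n ≤
      maxShareSize n := by
  have he1 := Real.exp_one_gt_d9
  have he2 := Real.exp_one_lt_d9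
  have hn' : (3 : ℝ) ≤ n := by exact_mod_cast hn
  set r := ⌊(n : ℝ) / Real.exp 1⌋₊ with hrdef
  have hr1 : 1 ≤ r := by
    rw [hrdef, Nat.one_le_floor_iff, one_le_div (Real.exp_pos 1)]
    linarith
  have hle : (r : ℝ) ≤ n / Real.exp 1 := Nat.floor_le (by positivity)
  have hlt : (n : ℝ) / Real.exp 1 < r + 1 := Nat.lt_floor_add_one _
  have hrn : r < n := by
    have : (n : ℝ) / Real.exp 1 < n := div_lt_self (by linarith) (by linarith)
    exact_mod_cast hle.trans_lt this
  have hrpos : (0 : ℝ) < r := by exact_mod_cast hr1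
  have hM := shareSize_le_maxShareSize (n := n) (i := n - r) (by omega) (by omega)
  rw [shareSize_sub hr1 hrn.le] at hM
  refine le_trans ?_ hM
  have h1 := mul_le_mul_of_nonneg_left (le_sum_Ico_inv hr1 hrn.le) hrpos.le
  refine le_trans ?_ h1
  -- the tangent bound for `log` at `1 / e`
  have hlog : Real.log r - Real.log n ≤ r * Real.exp 1 / n - 2 := by
    have h := Real.log_le_sub_one_of_pos (show 0 < r * Real.exp 1 / n by positivity)
    rw [Real.log_div (by positivity) (by positivity), Real.log_mul hrpos.ne'
      (Real.exp_pos 1).ne', Real.log_exp] at h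
    linarith
  set e := Real.exp 1
  have e1 : (r : ℝ) * (Real.log n - 1 / (2 * n) - (Real.log r - 1 / (2 * r))) =
      1 / 2 - r / (2 * n) - r * (Real.log r - Real.log n) := by
    field_simp
    ring
  have h2 := mul_le_mul_of_nonneg_left hlog hrpos.le
  obtain ⟨d, hd⟩ : ∃ d, (n : ℝ) / e = r + d := ⟨n / e - r, by ring⟩
  have hd0 : 0 ≤ d := by linarith
  have hd1 : d ≤ 1 := by linarith
  have hnd : (n : ℝ) = (r + d) * e := by rw [← hd]; field_simp
  have e2 : (r : ℝ) * (r * e / n - 2) = d ^ 2 * e / n - n / e := by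
    rw [hd, show (r : ℝ) = n / e - d by linarith]
    field_simp
    ring
  have e3 : (e - 1) / (2 * e) = 1 / 2 - 1 / (2 * e) := by
    field_simp
  have h3 : (r : ℝ) / (2 * n) ≤ 1 / (2 * e) := by
    rw [div_le_div_iff₀ (by positivity) (by positivity), hnd]
    nlinarith
  have h4 : d ^ 2 * e / n ≤ e / n := by
    gcongr
    exact mul_le_of_le_one_left (Real.exp_pos 1).le (pow_le_one₀ hd0 hd1)
  rw [e1, e3]
  linarith

lemma isBigO_maxShareSize :
    (fun n : ℕ => maxShareSize n -
        ((n : ℝ) / Real.exp 1 + (Real.exp 1 - 1) / (2 * Real.exp 1)))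
      =O[atTop] (fun n : ℕ => 1 / (n : ℝ)) := by
  refine IsBigO.of_bound (Real.exp 1) ?_
  filter_upwards [eventually_ge_atTop 3] with n hn
  have hn' : (0 : ℝ) < n := by exact_mod_cast (by omega : 0 < n)
  have h1 := maxShareSize_lt (show 2 ≤ n by omega)
  have h2 := le_maxShareSize hn
  have h3 : 1 / (3 * (n : ℝ)) ≤ Real.exp 1 / n := by
    rw [div_le_div_iff₀ (by positivity) hn']
    nlinarith [Real.exp_one_gt_d9]
  rw [Real.norm_eq_abs, Real.norm_of_nonneg (by positivity), mul_one_div, abs_le]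
  constructor <;> linarith

end Analysis

/-! ### The complexity of universal access structures -/

section Universal

variable {P : Type u}

lemma level_le [Finite P] (Γ : UpperSet (Set P)) (p : P) :
    level Γ p ≤ (minimalQualified Γ).ncard :=
  Set.ncard_le_ncard (fun _ hA => hA.1) (Set.toFinite _)

lemma exists_level_eq {n : ℕ} {Γ : UpperSet (Set P)} (hΓ : (minimalQualified Γ).ncard = n)
    {i : ℕ} (hi : i ≤ n)
    (h : ∀ E ⊆ minimalQualified Γ, E.ncard = i → (participantClass Γ E).Nonempty) :
    ∃ p, level Γ p = i := by
  obtain ⟨E, hE, hcard⟩ := Set.exists_subset_card_eq (hΓ.symm ▸ hi : i ≤ (minimalQualified Γ).ncard)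
  obtain ⟨p, hp⟩ := h E hE hcard
  refine ⟨p, ?_⟩
  rw [level, ← hcard]
  congr 1
  ext A
  exact ⟨fun hA => (hp A hA.1).mp hA.2, fun hA => ⟨hE hA, (hp A (hE hA)).mpr hA⟩⟩

/-- The scheme of complexity `M_n`: only levels `0` and `n`, with share sizes `0` and `1 = f_n(1)`,
are not covered by the maximum defining `M_n`. -/
lemma exists_realizes_complexity_eq {n : ℕ} (hn : 2 ≤ n) [Finite P] {Γ : UpperSet (Set P)}
    (hΓ : (minimalQualified Γ).ncard = n)
    (h : ∀ E ⊆ minimalQualified Γ, E.Nonempty → E ≠ minimalQualified Γ →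
      (participantClass Γ E).Nonempty) :
    ∃ S : SecretSharingScheme P, S.Realizes Γ ∧
      (∀ p, S.relativeSize p = shareSize n (level Γ p)) ∧ S.complexity = maxShareSize n := by
  obtain ⟨S, hS, hsize⟩ := exists_realizes_relativeSize_eq (by omega) hΓ fun A hA =>
    h {A} (by simpa using hA) (Set.singleton_nonempty A) fun h0 => by
      rw [← h0, Set.ncard_singleton] at hΓ
      omega
  refine ⟨S, hS, hsize, ?_⟩
  have hlevel (i : ℕ) (hi : 1 ≤ i) (hin : i < n) : ∃ p, level Γ p = i :=
    exists_level_eq hΓ hin.le fun E hE hcard => h E hE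
      (Set.nonempty_of_ncard_ne_zero (by omega)) fun h0 => by
        rw [h0, hΓ] at hcard
        omega
  have hbdd : BddAbove (Set.range S.relativeSize) := (Set.finite_range _).bddAbove
  have hone : 1 ≤ maxShareSize n := by
    rw [← shareSize_one hn]
    exact shareSize_le_maxShareSize le_rfl (by omega)
  have : Nonempty P := (hlevel 1 le_rfl (by omega)).nonempty
  refine le_antisymm (ciSup_le fun p => ?_) ?_
  · rw [hsize]
    have hle : level Γ p ≤ n := hΓ ▸ level_le Γ p
    rcases Nat.eq_zero_or_pos (level Γ p) with h0 | h0
    · rw [h0, shareSize_zero (by omega)]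
      linarith
    · rcases hle.lt_or_eq with h1 | h1
      · exact shareSize_le_maxShareSize h0 h1
      · rwa [h1, shareSize_self]
  · obtain ⟨i, hi, hin, hmax⟩ := exists_maxShareSize_eq hn
    obtain ⟨p, hp⟩ := hlevel i hi hin
    rw [hmax, ← hp, ← hsize]
    exact le_ciSup hbdd p

lemma IsUniversal.exists_realizes {n : ℕ} (hn : 2 ≤ n) [Finite P] {Γ : UpperSet (Set P)}
    (hΓ : IsUniversal n Γ) :
    ∃ S : SecretSharingScheme P, S.Realizes Γ ∧
      (∀ p, S.relativeSize p = shareSize n (level Γ p)) ∧ S.complexity = maxShareSize n :=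
  exists_realizes_complexity_eq hn hΓ.1 fun E hE _ _ => hΓ.2 E hE

lemma IsUniversal.accessComplexity_le {n : ℕ} (hn : 2 ≤ n) [Finite P] {Γ : UpperSet (Set P)}
    (hΓ : IsUniversal n Γ) : accessComplexity Γ ≤ maxShareSize n := by
  obtain ⟨S, hS, -, hmax⟩ := hΓ.exists_realizes hn
  exact hmax ▸ _root_.accessComplexity_le S hS

lemma IsUniversal.accessComplexity_le_one [Finite P] {Γ : UpperSet (Set P)}
    (hΓ : IsUniversal 1 Γ) : accessComplexity Γ ≤ 1 := by
  obtain ⟨S, hS, hsize⟩ := exists_realizes_relativeSize_eq le_rfl hΓ.1 fun A hA =>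
    hΓ.2 {A} (by simpa using hA)
  refine (_root_.accessComplexity_le S hS).trans (Real.iSup_le (fun p => ?_) zero_le_one)
  rw [hsize]
  have hle : level Γ p ≤ 1 := hΓ.1 ▸ level_le Γ p
  rcases Nat.le_one_iff_eq_zero_or_eq_one.mp hle with h | h
  · rw [h, shareSize_zero le_rfl]
    exact zero_le_one
  · rw [h, shareSize_self]

end Universal

theorem mainTheorem1 :
    -- the symmetric schemes for the normalized universal structures
    (∀ n : ℕ, 2 ≤ n → ∀ (P : Type u) [Finite P] (Γ : UpperSet (Set P)), IsNormalizedUniversal n Γ →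
      ∃ S : SecretSharingScheme P, S.Realizes Γ ∧
        (∀ p, S.relativeSize p = shareSize n (level Γ p)) ∧ S.complexity = maxShareSize n) ∧
    -- the schemes for arbitrary universal structures
    (∀ n : ℕ, 2 ≤ n → ∀ (P : Type u) [Finite P] (Γ : UpperSet (Set P)), IsUniversal n Γ →
      (∃ S : SecretSharingScheme P, S.Realizes Γ ∧
        (∀ p, S.relativeSize p = shareSize n (level Γ p)) ∧ S.complexity = maxShareSize n) ∧
      accessComplexity Γ ≤ maxShareSize n) ∧
    -- the asymptotic value of the maximum
    (fun n : ℕ => maxShareSize n -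
        ((n : ℝ) / Real.exp 1 + (Real.exp 1 - 1) / (2 * Real.exp 1)))
      =O[atTop] (fun n : ℕ => 1 / (n : ℝ)) ∧
    -- the complexity of universal structures is at most `n / e + O(1)`
    (∃ C : ℝ, ∀ n : ℕ, 1 ≤ n → ∀ (P : Type u) [Finite P] (Γ : UpperSet (Set P)), IsUniversal n Γ →
      accessComplexity Γ ≤ (n : ℝ) / Real.exp 1 + C) ∧
    -- the non-asymptotic bounds
    (∀ n : ℕ, 2 ≤ n →
      maxShareSize n <
        (n : ℝ) / Real.exp 1 + (Real.exp 1 - 1) / (2 * Real.exp 1) + 1 / (3 * (n : ℝ)) ∧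
      (n : ℝ) / Real.exp 1 + (Real.exp 1 - 1) / (2 * Real.exp 1) + 1 / (3 * (n : ℝ)) <
        (n : ℝ) / Real.exp 1 + 1 / 2) ∧
    (∀ n : ℕ, 2 ≤ n → ∀ (P : Type u) [Finite P] (Γ : UpperSet (Set P)), IsUniversal n Γ →
      accessComplexity Γ < (n : ℝ) / Real.exp 1 + 1 / 2) := by
  refine ⟨?_, ?_, isBigO_maxShareSize, ⟨1, ?_⟩, fun n hn => ⟨maxShareSize_lt hn,
    bound_lt_div_exp_add_half hn⟩, fun n hn P _ Γ hΓ => (hΓ.accessComplexity_le hn).trans_lt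
      ((maxShareSize_lt hn).trans (bound_lt_div_exp_add_half hn))⟩
  · intro n hn P _ Γ hΓ
    refine exists_realizes_complexity_eq hn hΓ.1 fun E hE h0 h1 => ?_
    obtain ⟨p, hp⟩ := hΓ.2.1 E hE h0.ne_empty h1
    exact hp ▸ Set.singleton_nonempty p
  · exact fun n hn P _ Γ hΓ => ⟨hΓ.exists_realizes hn, hΓ.accessComplexity_le hn⟩
  · intro n hn P _ Γ hΓ
    rcases hn.eq_or_lt with rfl | hn
    · have : (0 : ℝ) ≤ ((1 : ℕ) : ℝ) / Real.exp 1 := by positivity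
      linarith [hΓ.accessComplexity_le_one]
    · linarith [hΓ.accessComplexity_le hn, maxShareSize_lt hn, bound_lt_div_exp_add_half hn]
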